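/- **Setting.** Let $\mathbb M^d=\bigcup_{m\ge 1} M_m(\mathbb C)^d$ and let $\mathbb P_d$ be the algebra of free polynomials in $d$ non-commuting variables. Let $J\ge 1$, let $\delta$ be a $J\times J$ matrix with entries in $\mathbb P_d$, and let $G_\delta=\{x\in\mathbb M^d:\|\delta(x)\|<1\}$. For Hilbert spaces $\mathcal H,\mathcal K$, an $\mathcal L(\mathcal H,\mathcal K)$-valued graded function $\Theta$ assigns to $x\in M_m(\mathbb C)^d$ an operator $\Theta(x):\mathbb C^m\otimes\mathcal H\to\mathbb C^m\otimes\mathcal K$. It is an nc-function on $D$ if $\Theta(x\oplus y)=\Theta(x)\oplus\Theta(y)$ whenever $x,y,x\oplus y\in D$, and $\Theta(s^{-1}xs)=(s^{-1}\otimes I)\Theta(x)(s\otimes I)$ whenever $s$ is invertible and $x,s^{-1}xs\in D$. It is free holomorphic on $G_\delta$ if every $x\in G_\delta$ lies in some $G_\varepsilon\subseteq G_\delta$ ($\varepsilon$ a square matrix of free polynomials) on which $\Theta$ is a bounded nc-function. The set $\mathrm{ball}(H^\infty_{\mathcal L(\mathcal H,\mathcal K)}(G_\delta))$ consists of the free holomorphic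 $\Theta$ with $\|\Theta(x)\|\le 1$ on $G_\delta$; for scalar functions ($\mathcal H=\mathcal K=\mathbb C$) it is written $\mathrm{ball}(H^\infty(G_\delta))$. Let $\Lambda\in G_\delta$ consist of $n\times n$ matrices and let $p_0\in\mathbb P_d$ be such that the Pick problem $\Lambda\mapsto p_0(\Lambda)$ is solvable, i.e. some $\psi\in\mathrm{ball}(H^\infty(G_\delta))$ has $\psi(\Lambda)=p_0(\Lambda)$. **Data.** Consider a finite-dimensional Hilbert space $L$ and an $\mathcal L(\mathbb C,\mathbb C^J\otimes L)$-valued free polynomial $u$ with $$ I-p_0(\Lambda)^*p_0(\Lambda)=u(\Lambda)^*\big[I-\delta(\Lambda)^*\delta(\Lambda)\otimes I_L\big]u(\Lambda). \tag{4.2}$$ Let $\pi_k:\mathbb C^n\to\mathbb C$ be the $k$-th coordinate functional. In $\mathcal E=\mathbb C\oplus(\mathbb C^J\otimes L)$ let $\mathcal N_2$ be the span of the vectors $p_{k,v}=(\pi_k\otimes I)\begin{bmatrix} I\\ (\delta(\Lambda)\otimes I_L)u(\Lambda)\end{bmatrix}v$ and $\mathcal N_1$ the span of the vectors $q_{k,v}=(\pi_k\otimes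 I)\begin{bmatrix} p_0(\Lambda)\\ u(\Lambda)\end{bmatrix}v$, where $1\le k\le n$ and $v\in\mathbb C^n$. Suppose also that there is a (necessarily unique) isometry $V$ of $\mathcal N_2$ onto $\mathcal N_1$ with $Vp_{k,v}=q_{k,v}$ for all $k,v$. Put $\mathcal M_i=\mathcal E\ominus\mathcal N_i$. The unitary $$\mathcal M_1\oplus\mathcal M_2\oplus\mathcal N_2\to\mathcal M_2\oplus\mathcal M_1\oplus\mathcal N_1,\qquad (m_1,m_2,n_2)\mapsto(m_2,m_1,Vn_2),$$ becomes, via $\mathcal E=\mathcal M_i\oplus\mathcal N_i$, a unitary $U:(\mathbb C\oplus\mathcal M_1)\oplus(\mathbb C^J\otimes L)\to(\mathbb C\oplus\mathcal M_2)\oplus(\mathbb C^J\otimes L)$. Write $U=\begin{bmatrix}A&B\\C&D\end{bmatrix}$ and let $$G(x)=I\otimes A+(I\otimes B)(\delta(x)\otimes I_L)\big[I-(I\otimes D)(\delta(x)\otimes I_L)\big]^{-1}(I\otimes C)$$ be its transfer function on $G_\delta$, with entries $G_{11},G_{12},G_{21},G_{22}$ with respect to $\mathbb C\oplus\mathcal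 M_1\to\mathbb C\oplus\mathcal M_2$. **Theorem.** For all such data, every $x\in G_\delta$ and every $\Theta\in\mathrm{ball}(H^\infty_{\mathcal L(\mathcal M_2,\mathcal M_1)}(G_\delta))$, the operators $I-(I\otimes D)(\delta(x)\otimes I_L)$ and $I-G_{22}(x)\Theta(x)$ are invertible. A function $\phi\in\mathrm{ball}(H^\infty(G_\delta))$ satisfies $\phi(\Lambda)=p_0(\Lambda)$ if and only if there exist data $L,u,V$ as above, with associated $G$, and a function $\Theta\in\mathrm{ball}(H^\infty_{\mathcal L(\mathcal M_2,\mathcal M_1)}(G_\delta))$ such that, on $G_\delta$, $$\phi=G_{11}+G_{12}\,\Theta\,(I-G_{22}\Theta)^{-1}G_{21}.$$ -/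

import Mathlib

noncomputable section

namespace FreePick

/-! ### Tensor products `ℂ^m ⊗ H`, block operators -/

/-- The Hilbert space `ℂ^m ⊗ H`, i.e. the orthogonal direct sum of `m` copies of `H`. -/
abbrev Tens (m : ℕ) (H : Type) [NormedAddCommGroup H] : Type := PiLp 2 (fun _ : Fin m => H)

section Operators

variable {H K : Type} [NormedAddCommGroup H] [InnerProductSpace ℂ H]
  [NormedAddCommGroup K] [InnerProductSpace ℂ K]

/-- The operator `ℂ^k ⊗ H → ℂ^m ⊗ K` with block entries `T i j : H → K`. -/
def blockOp {m k : ℕ} (T : Fin m → Fin k → H →L[ℂ] K) : Tens k H →L[ℂ] Tens m K :=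
  ((PiLp.continuousLinearEquiv 2 ℂ (fun _ : Fin m => K)).symm :
      (Fin m → K) →L[ℂ] Tens m K) ∘L
    ContinuousLinearMap.pi (fun i => ∑ j, T i j ∘L PiLp.proj 2 (fun _ : Fin k => H) j)

@[simp] theorem blockOp_apply {m k : ℕ} (T : Fin m → Fin k → H →L[ℂ] K) (v : Tens k H)
    (i : Fin m) : blockOp T v i = ∑ j, T i j (v j) := by
  simp [blockOp]

/-- `id_{ℂ^m} ⊗ T`. -/
def ampl (m : ℕ) (T : H →L[ℂ] K) : Tens m H →L[ℂ] Tens m K :=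
  blockOp (fun i j => if i = j then T else 0)

variable (H) in
/-- `A ⊗ id_H`, for a matrix `A`. -/
def tensId {m k : ℕ} (A : Matrix (Fin m) (Fin k) ℂ) : Tens k H →L[ℂ] Tens m H :=
  blockOp (fun i j => A i j • ContinuousLinearMap.id ℂ H)

/-- The operator `ℂ → K`, `c ↦ c • v`. -/
def ofVec (v : K) : ℂ →L[ℂ] K := ContinuousLinearMap.toSpanSingleton ℂ v

end Operators

/-! ### Free polynomials and basic free open sets -/

/-- `d`-tuples of `m × m` complex matrices. -/
abbrev Tup (d m : ℕ) : Type := Fin d → Matrix (Fin m) (Fin m) ℂ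

/-- The algebra of free polynomials in `d` variables. -/
abbrev Poly (d : ℕ) : Type := FreeAlgebra ℂ (Fin d)

/-- The value `p(x)` of a free polynomial at a tuple of matrices. -/
def polyEval {d m : ℕ} (p : Poly d) (x : Tup d m) : Matrix (Fin m) (Fin m) ℂ :=
  FreeAlgebra.lift ℂ x p

/-- `J × J` matrices of free polynomials. -/
abbrev PolyMat (d J : ℕ) : Type := Matrix (Fin J) (Fin J) (Poly d)

/-- `δ(x) ⊗ id_L` as an operator on `ℂ^m ⊗ (ℂ^J ⊗ L)`. -/
def deltaOp {d J m : ℕ} (δ : PolyMat d J) (x : Tup d m)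
    (L : Type) [NormedAddCommGroup L] [InnerProductSpace ℂ L] :
    Tens m (Tens J L) →L[ℂ] Tens m (Tens J L) :=
  blockOp (fun i j => blockOp (fun a b =>
    polyEval (δ a b) x i j • ContinuousLinearMap.id ℂ L))

/-- The `m`-th level of the basic free open set `G_δ = {x : ‖δ(x)‖ < 1}`; matrices of size `0`
are not points. -/
def gdel {d J : ℕ} (δ : PolyMat d J) (m : ℕ) : Set (Tup d m) :=
  {x | 0 < m ∧ ‖deltaOp δ x ℂ‖ < 1}

/-! ### Graded functions, nc-functions, bounded free holomorphic functions -/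

/-- `𝓛(H, K)`-valued graded functions: `Θ(x) : ℂ^m ⊗ H → ℂ^m ⊗ K` for a tuple `x` of
`m × m` matrices.  Only the values on the domain under consideration matter. -/
abbrev OpGraded (d : ℕ) (H K : Type) [NormedAddCommGroup H] [InnerProductSpace ℂ H]
    [NormedAddCommGroup K] [InnerProductSpace ℂ K] : Type :=
  (m : ℕ) → Tup d m → (Tens m H →L[ℂ] Tens m K)

/-- Scalar graded functions: `φ(x)` is an `m × m` matrix if `x` is a tuple of such. -/
abbrev Graded (d : ℕ) : Type := (m : ℕ) → Tup d m → Matrix (Fin m) (Fin m) ℂ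

/-- The direct sum of two tuples of matrices. -/
def dsum {d m k : ℕ} (x : Tup d m) (y : Tup d k) : Tup d (m + k) :=
  fun r => (Matrix.fromBlocks (x r) 0 0 (y r)).reindex finSumFinEquiv finSumFinEquiv

/-- The first component of a vector in `ℂ^(m+k) ⊗ H = (ℂ^m ⊗ H) ⊕ (ℂ^k ⊗ H)`. -/
def fstPart {H : Type} [NormedAddCommGroup H] {m k : ℕ} (v : Tens (m + k) H) : Tens m H :=
  WithLp.toLp 2 (fun i => v (Fin.castAdd k i))

/-- The second component of a vector in `ℂ^(m+k) ⊗ H = (ℂ^m ⊗ H) ⊕ (ℂ^k ⊗ H)`. -/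
def sndPart {H : Type} [NormedAddCommGroup H] {m k : ℕ} (v : Tens (m + k) H) : Tens k H :=
  WithLp.toLp 2 (fun i => v (Fin.natAdd m i))

section Hinf

variable {d : ℕ} {H K : Type} [NormedAddCommGroup H] [InnerProductSpace ℂ H]
  [NormedAddCommGroup K] [InnerProductSpace ℂ K]

/-- `Θ` is an nc-function on the set `D`: it respects direct sums and similarities. -/
structure IsNC (D : (m : ℕ) → Set (Tup d m)) (Θ : OpGraded d H K) : Prop where
  dsum : ∀ {m k : ℕ} (x : Tup d m) (y : Tup d k), x ∈ D m → y ∈ D k → dsum x y ∈ D (m + k) →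
    ∀ v : Tens (m + k) H,
      fstPart (Θ (m + k) (FreePick.dsum x y) v) = Θ m x (fstPart v) ∧
      sndPart (Θ (m + k) (FreePick.dsum x y) v) = Θ k y (sndPart v)
  similar : ∀ {m : ℕ} (x : Tup d m) (s : (Matrix (Fin m) (Fin m) ℂ)ˣ), x ∈ D m →
    (fun r => (↑s⁻¹ : Matrix (Fin m) (Fin m) ℂ) * x r * s) ∈ D m →
      Θ m (fun r => (↑s⁻¹ : Matrix (Fin m) (Fin m) ℂ) * x r * s) =
        tensId K (↑s⁻¹ : Matrix (Fin m) (Fin m) ℂ) ∘L Θ m x ∘L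
          tensId H (s : Matrix (Fin m) (Fin m) ℂ)

/-- `Θ` is free holomorphic on `D`: every point of `D` lies in a basic free open subset of `D` on
which `Θ` is a bounded nc-function. -/
def IsFreeHolo (D : (m : ℕ) → Set (Tup d m)) (Θ : OpGraded d H K) : Prop :=
  ∀ (m : ℕ) (x : Tup d m), x ∈ D m → ∃ (J : ℕ) (ε : PolyMat d J), 0 < J ∧
    x ∈ gdel ε m ∧ (∀ k, gdel ε k ⊆ D k) ∧ IsNC (gdel ε) Θ ∧
    ∃ C : ℝ, ∀ (k : ℕ) (y : Tup d k), y ∈ gdel ε k → ‖Θ k y‖ ≤ C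

/-- `Θ` belongs to the closed unit ball of `H^∞_{𝓛(H, K)}(D)`. -/
def InBall (D : (m : ℕ) → Set (Tup d m)) (Θ : OpGraded d H K) : Prop :=
  IsFreeHolo D Θ ∧ ∀ (m : ℕ) (x : Tup d m), x ∈ D m → ‖Θ m x‖ ≤ 1

end Hinf

/-- A scalar graded function as an operator-valued one, through `M_m = 𝓛(ℂ^m)`. -/
def Graded.toOp {d : ℕ} (φ : Graded d) : OpGraded d ℂ ℂ := fun m x => tensId ℂ (φ m x)

/-! ### Transfer functions -/

section Transfer

/-- The Hilbert space direct sum `E ⊕ F`. -/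
abbrev HSum (E F : Type) [NormedAddCommGroup E] [NormedAddCommGroup F] : Type :=
  WithLp 2 (E × F)

variable {E F S : Type} [NormedAddCommGroup E] [InnerProductSpace ℂ E]
  [NormedAddCommGroup F] [InnerProductSpace ℂ F]
  [NormedAddCommGroup S] [InnerProductSpace ℂ S]

instance [FiniteDimensional ℂ E] [FiniteDimensional ℂ F] : FiniteDimensional ℂ (HSum E F) :=
  Module.Finite.equiv (WithLp.linearEquiv 2 ℂ (E × F)).symm

variable (E F) in
/-- The inclusion `E → E ⊕ F`. -/
def inlL : E →L[ℂ] HSum E F :=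
  ((WithLp.prodContinuousLinearEquiv 2 ℂ E F).symm : E × F →L[ℂ] HSum E F) ∘L
    ContinuousLinearMap.inl ℂ E F

variable (E F) in
/-- The inclusion `F → E ⊕ F`. -/
def inrL : F →L[ℂ] HSum E F :=
  ((WithLp.prodContinuousLinearEquiv 2 ℂ E F).symm : E × F →L[ℂ] HSum E F) ∘L
    ContinuousLinearMap.inr ℂ E F

variable (E F) in
/-- The projection `E ⊕ F → E`. -/
abbrev fstL : HSum E F →L[ℂ] E := WithLp.fstL 2 ℂ E F

variable (E F) in
/-- The projection `E ⊕ F → F`. -/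
abbrev sndL : HSum E F →L[ℂ] F := WithLp.sndL 2 ℂ E F

/-- The block `A` of `U = [[A, B], [C, D]] : E ⊕ S → F ⊕ S`. -/
def blockA (U : HSum E S →L[ℂ] HSum F S) : E →L[ℂ] F := fstL F S ∘L U ∘L inlL E S

/-- The block `B` of `U = [[A, B], [C, D]]`. -/
def blockB (U : HSum E S →L[ℂ] HSum F S) : S →L[ℂ] F := fstL F S ∘L U ∘L inrL E S

/-- The block `C` of `U = [[A, B], [C, D]]`. -/
def blockC (U : HSum E S →L[ℂ] HSum F S) : E →L[ℂ] S := sndL F S ∘L U ∘L inlL E S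

/-- The block `D` of `U = [[A, B], [C, D]]`. -/
def blockD (U : HSum E S →L[ℂ] HSum F S) : S →L[ℂ] S := sndL F S ∘L U ∘L inrL E S

variable {d J : ℕ} {L : Type} [NormedAddCommGroup L] [InnerProductSpace ℂ L]

/-- The operator `id - (id_{ℂ^m} ⊗ D)(δ(x) ⊗ id_L)`, whose inverse occurs in the transfer
function. -/
def pencil (δ : PolyMat d J) (U : HSum E (Tens J L) →L[ℂ] HSum F (Tens J L))
    {m : ℕ} (x : Tup d m) : Tens m (Tens J L) →L[ℂ] Tens m (Tens J L) :=
  1 - ampl m (blockD U) ∘L deltaOp δ x L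

/-- The transfer function of `U : E ⊕ (ℂ^J ⊗ L) → F ⊕ (ℂ^J ⊗ L)`,
`x ↦ id ⊗ A + (id ⊗ B)(δ(x) ⊗ id_L) [id - (id ⊗ D)(δ(x) ⊗ id_L)]⁻¹ (id ⊗ C)`. -/
def transfer (δ : PolyMat d J) (U : HSum E (Tens J L) →L[ℂ] HSum F (Tens J L)) :
    OpGraded d E F := fun m x =>
  ampl m (blockA U) +
    ampl m (blockB U) ∘L deltaOp δ x L ∘L Ring.inverse (pencil δ U x) ∘L ampl m (blockC U)

end Transfer

/-! ### The unitary built from a factorization -/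

section Unitary

variable {A B B' C : Type} [NormedAddCommGroup A] [InnerProductSpace ℂ A]
  [NormedAddCommGroup B] [InnerProductSpace ℂ B]
  [NormedAddCommGroup B'] [InnerProductSpace ℂ B']
  [NormedAddCommGroup C] [InnerProductSpace ℂ C]

variable (A B C) in
/-- The identification `(A ⊕ B) ⊕ C = B ⊕ (A ⊕ C)`. -/
def regroup : HSum (HSum A B) C ≃ₗᵢ[ℂ] HSum B (HSum A C) where
  toFun z := WithLp.toLp 2 (z.fst.snd, WithLp.toLp 2 (z.fst.fst, z.snd))
  invFun z := WithLp.toLp 2 (WithLp.toLp 2 (z.snd.fst, z.fst), z.snd.snd)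
  map_add' _ _ := rfl
  map_smul' _ _ := rfl
  left_inv _ := rfl
  right_inv _ := rfl
  norm_map' z := by
    rw [← sq_eq_sq₀ (by positivity) (by positivity)]
    change ‖WithLp.toLp 2 (z.fst.snd, WithLp.toLp 2 (z.fst.fst, z.snd))‖ ^ 2 = _
    simp only [WithLp.prod_norm_sq_eq_of_L2, WithLp.toLp_fst, WithLp.toLp_snd]
    ring

variable (A) in
/-- `id_A ⊕ W`, for a unitary `W`. -/
def sumRight (W : B ≃ₗᵢ[ℂ] B') : HSum A B ≃ₗᵢ[ℂ] HSum A B' where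
  toFun z := WithLp.toLp 2 (z.fst, W z.snd)
  invFun z := WithLp.toLp 2 (z.fst, W.symm z.snd)
  map_add' z w := WithLp.ofLp_injective 2 (Prod.ext (by simp) (by simp))
  map_smul' c z := WithLp.ofLp_injective 2 (Prod.ext (by simp) (by simp))
  left_inv z := WithLp.ofLp_injective 2 (Prod.ext (by simp) (by simp))
  right_inv z := WithLp.ofLp_injective 2 (Prod.ext (by simp) (by simp))
  norm_map' z := by
    rw [← sq_eq_sq₀ (by positivity) (by positivity)]
    change ‖WithLp.toLp 2 (z.fst, W z.snd)‖ ^ 2 = _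
    simp only [WithLp.prod_norm_sq_eq_of_L2, WithLp.toLp_fst, WithLp.toLp_snd,
      LinearIsometryEquiv.norm_map]

variable {N₂ N₁ M₂ M₁ : Type} [NormedAddCommGroup N₂] [InnerProductSpace ℂ N₂]
  [NormedAddCommGroup N₁] [InnerProductSpace ℂ N₁]
  [NormedAddCommGroup M₂] [InnerProductSpace ℂ M₂]
  [NormedAddCommGroup M₁] [InnerProductSpace ℂ M₁]

variable (M₂ M₁) in
/-- The unitary `(m₁, m₂, n₂) ↦ (m₂, m₁, V n₂)` from `M₁ ⊕ M₂ ⊕ N₂` to `M₂ ⊕ M₁ ⊕ N₁`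
(with the summands grouped as `M₁ ⊕ (N₂ ⊕ M₂)` and `M₂ ⊕ (N₁ ⊕ M₁)`). -/
def swapV (V : N₂ ≃ₗᵢ[ℂ] N₁) : HSum M₁ (HSum N₂ M₂) ≃ₗᵢ[ℂ] HSum M₂ (HSum N₁ M₁) where
  toFun z := WithLp.toLp 2 (z.snd.snd, WithLp.toLp 2 (V z.snd.fst, z.fst))
  invFun z := WithLp.toLp 2 (z.snd.snd, WithLp.toLp 2 (V.symm z.snd.fst, z.fst))
  map_add' z w := by
    refine WithLp.ofLp_injective 2 (Prod.ext (by simp) ?_)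
    exact WithLp.ofLp_injective 2 (Prod.ext (by simp) (by simp))
  map_smul' c z := by
    refine WithLp.ofLp_injective 2 (Prod.ext (by simp) ?_)
    exact WithLp.ofLp_injective 2 (Prod.ext (by simp) (by simp))
  left_inv z := by
    refine WithLp.ofLp_injective 2 (Prod.ext (by simp) ?_)
    exact WithLp.ofLp_injective 2 (Prod.ext (by simp) (by simp))
  right_inv z := by
    refine WithLp.ofLp_injective 2 (Prod.ext (by simp) ?_)
    exact WithLp.ofLp_injective 2 (Prod.ext (by simp) (by simp))
  norm_map' z := by
    rw [← sq_eq_sq₀ (by positivity) (by positivity)]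
    change ‖WithLp.toLp 2 (z.snd.snd, WithLp.toLp 2 (V z.snd.fst, z.fst))‖ ^ 2 = _
    simp only [WithLp.prod_norm_sq_eq_of_L2, WithLp.toLp_fst, WithLp.toLp_snd,
      LinearIsometryEquiv.norm_map]
    ring

variable {S : Type} [NormedAddCommGroup S] [InnerProductSpace ℂ S]

/-- The unitary `ℂ ⊕ M₁ ⊕ S → ℂ ⊕ M₂ ⊕ S` obtained from `(m₁, m₂, n₂) ↦ (m₂, m₁, V n₂)` through
identifications `W₂ : ℂ ⊕ S = N₂ ⊕ M₂` (on the left) and `W₁ : ℂ ⊕ S = N₁ ⊕ M₁` (on the right). -/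
def unitaryAux (W₂ : HSum ℂ S ≃ₗᵢ[ℂ] HSum N₂ M₂) (W₁ : HSum ℂ S ≃ₗᵢ[ℂ] HSum N₁ M₁)
    (V : N₂ ≃ₗᵢ[ℂ] N₁) : HSum (HSum ℂ M₁) S ≃ₗᵢ[ℂ] HSum (HSum ℂ M₂) S :=
  (regroup ℂ M₁ S).trans <| (sumRight M₁ W₂).trans <| (swapV M₂ M₁ V).trans <|
    (sumRight M₂ W₁.symm).trans (regroup ℂ M₂ S).symm

/-- The orthogonal decomposition `ℂ ⊕ S = N ⊕ Nᗮ`. -/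
def decomp [FiniteDimensional ℂ S] (N : Submodule ℂ (HSum ℂ S)) :
    HSum ℂ S ≃ₗᵢ[ℂ] HSum N Nᗮ :=
  N.orthogonalDecomposition

/-- For an isometry `V` of a subspace `N₂` onto a subspace `N₁` of `𝓛 = ℂ ⊕ S`, and
`M_i = 𝓛 ⊖ N_i`: the unitary `ℂ ⊕ M₁ ⊕ S → ℂ ⊕ M₂ ⊕ S` obtained from
`(m₁, m₂, n₂) ↦ (m₂, m₁, V n₂)` through the orthogonal decompositions `𝓛 = N₂ ⊕ M₂` and
`𝓛 = N₁ ⊕ M₁`. -/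
def unitaryOf [FiniteDimensional ℂ S]
    {N₂ N₁ : Submodule ℂ (HSum ℂ S)} (V : N₂ ≃ₗᵢ[ℂ] N₁) :
    HSum (HSum ℂ N₁ᗮ) S ≃ₗᵢ[ℂ] HSum (HSum ℂ N₂ᗮ) S :=
  unitaryAux (N₂ := N₂) (N₁ := N₁) (M₂ := N₂ᗮ) (M₁ := N₁ᗮ) (decomp N₂) (decomp N₁) V

end Unitary

/-! ### Factorizations of a Pick problem -/

section Pick

variable {d J n l : ℕ}

/-- The auxiliary space `ℂ^J ⊗ L`, with `L = ℂ^l`. -/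
abbrev Aux (J l : ℕ) : Type := Tens J (EuclideanSpace ℂ (Fin l))

/-- `𝓛(ℂ, ℂ^J ⊗ L)`-valued free polynomials, `L = ℂ^l`, given by their coordinates. -/
abbrev VecPoly (d J l : ℕ) : Type := Fin J → Fin l → Poly d

/-- The `(i, j)` entry of `u(x)`, a vector of `ℂ^J ⊗ L`. -/
def vecCoeff (u : VecPoly d J l) {m : ℕ} (x : Tup d m) (i j : Fin m) : Aux J l :=
  WithLp.toLp 2 (fun a => WithLp.toLp 2 (fun b => polyEval (u a b) x i j))

/-- The value `u(x) : ℂ^m → ℂ^m ⊗ (ℂ^J ⊗ L)`. -/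
def vecEval (u : VecPoly d J l) {m : ℕ} (x : Tup d m) : Tens m ℂ →L[ℂ] Tens m (Aux J l) :=
  blockOp (fun i j => ofVec (vecCoeff u x i j))

/-- `id - p₀(Λ)* p₀(Λ) = u(Λ)* [id - δ(Λ)* δ(Λ) ⊗ id_L] u(Λ)`. -/
def Factorization (δ : PolyMat d J) (Λ : Tup d n) (p₀ : Poly d) (u : VecPoly d J l) : Prop :=
  let P : Tens n ℂ →L[ℂ] Tens n ℂ := tensId ℂ (polyEval p₀ Λ)
  let Δ := deltaOp δ Λ (EuclideanSpace ℂ (Fin l))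
  1 - ContinuousLinearMap.adjoint P ∘L P =
    ContinuousLinearMap.adjoint (vecEval u Λ) ∘L (1 - ContinuousLinearMap.adjoint Δ ∘L Δ) ∘L vecEval u Λ

/-- `(π_k ⊗ id) [id ; (δ(Λ) ⊗ id_L) u(Λ)] v`, a vector of `ℂ ⊕ ℂ^J ⊗ L`. -/
def vecP (δ : PolyMat d J) (Λ : Tup d n) (u : VecPoly d J l) (k : Fin n) (v : Tens n ℂ) :
    HSum ℂ (Aux J l) :=
  WithLp.toLp 2 (v k, deltaOp δ Λ (EuclideanSpace ℂ (Fin l)) (vecEval u Λ v) k)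

/-- `(π_k ⊗ id) [p₀(Λ) ; u(Λ)] v`, a vector of `ℂ ⊕ ℂ^J ⊗ L`. -/
def vecQ (Λ : Tup d n) (p₀ : Poly d) (u : VecPoly d J l) (k : Fin n) (v : Tens n ℂ) :
    HSum ℂ (Aux J l) :=
  WithLp.toLp 2 (tensId ℂ (polyEval p₀ Λ) v k, vecEval u Λ v k)

/-- The subspace `N₂`, the span of the vectors `(π_k ⊗ id) [id ; (δ(Λ) ⊗ id_L) u(Λ)] v`. -/
def spaceN₂ (δ : PolyMat d J) (Λ : Tup d n) (u : VecPoly d J l) :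
    Submodule ℂ (HSum ℂ (Aux J l)) :=
  Submodule.span ℂ {z | ∃ k v, z = vecP δ Λ u k v}

/-- The subspace `N₁`, the span of the vectors `(π_k ⊗ id) [p₀(Λ) ; u(Λ)] v`. -/
def spaceN₁ (Λ : Tup d n) (p₀ : Poly d) (u : VecPoly d J l) :
    Submodule ℂ (HSum ℂ (Aux J l)) :=
  Submodule.span ℂ {z | ∃ k v, z = vecQ Λ p₀ u k v}

theorem vecP_mem (δ : PolyMat d J) (Λ : Tup d n) (u : VecPoly d J l) (k : Fin n)
    (v : Tens n ℂ) : vecP δ Λ u k v ∈ spaceN₂ δ Λ u :=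
  Submodule.subset_span ⟨k, v, rfl⟩

variable (δ : PolyMat d J) (Λ : Tup d n) (p₀ : Poly d) (u : VecPoly d J l)

/-- `V (π_k ⊗ id) [id ; (δ(Λ) ⊗ id_L) u(Λ)] = (π_k ⊗ id) [p₀(Λ) ; u(Λ)]` for all `k`. -/
def Intertwines (V : spaceN₂ δ Λ u ≃ₗᵢ[ℂ] spaceN₁ Λ p₀ u) : Prop :=
  ∀ (k : Fin n) (v : Tens n ℂ),
    (V ⟨vecP δ Λ u k v, vecP_mem δ Λ u k v⟩ : HSum ℂ (Aux J l)) = vecQ Λ p₀ u k v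

variable {δ Λ p₀ u}

/-- `M₁ = 𝓛 ⊖ N₁`; the isometry only serves to determine the data. -/
abbrev spM₁ (_V : spaceN₂ δ Λ u ≃ₗᵢ[ℂ] spaceN₁ Λ p₀ u) : Type := ↥(spaceN₁ Λ p₀ u)ᗮ

/-- `M₂ = 𝓛 ⊖ N₂`; the isometry only serves to determine the data. -/
abbrev spM₂ (_V : spaceN₂ δ Λ u ≃ₗᵢ[ℂ] spaceN₁ Λ p₀ u) : Type := ↥(spaceN₂ δ Λ u)ᗮ

variable (V : spaceN₂ δ Λ u ≃ₗᵢ[ℂ] spaceN₁ Λ p₀ u)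

/-- The unitary `U : (ℂ ⊕ M₁) ⊕ (ℂ^J ⊗ L) → (ℂ ⊕ M₂) ⊕ (ℂ^J ⊗ L)` as an operator. -/
def opU : HSum (HSum ℂ (spM₁ V)) (Aux J l) →L[ℂ] HSum (HSum ℂ (spM₂ V)) (Aux J l) :=
  ((unitaryOf V).toContinuousLinearEquiv :
    HSum (HSum ℂ (spM₁ V)) (Aux J l) →L[ℂ] HSum (HSum ℂ (spM₂ V)) (Aux J l))

/-- The transfer function `G` of `U`. -/
def fnG : OpGraded d (HSum ℂ (spM₁ V)) (HSum ℂ (spM₂ V)) := transfer δ (opU V)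

/-- The entry `G₁₁` of `G = [[G₁₁, G₁₂], [G₂₁, G₂₂]]`. -/
def fnG₁₁ : OpGraded d ℂ ℂ := fun m x =>
  ampl m (fstL ℂ (spM₂ V)) ∘L fnG V m x ∘L ampl m (inlL ℂ (spM₁ V))

/-- The entry `G₁₂` of `G`. -/
def fnG₁₂ : OpGraded d (spM₁ V) ℂ := fun m x =>
  ampl m (fstL ℂ (spM₂ V)) ∘L fnG V m x ∘L ampl m (inrL ℂ (spM₁ V))

/-- The entry `G₂₁` of `G`. -/
def fnG₂₁ : OpGraded d ℂ (spM₂ V) := fun m x =>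
  ampl m (sndL ℂ (spM₂ V)) ∘L fnG V m x ∘L ampl m (inlL ℂ (spM₁ V))

/-- The entry `G₂₂` of `G`. -/
def fnG₂₂ : OpGraded d (spM₁ V) (spM₂ V) := fun m x =>
  ampl m (sndL ℂ (spM₂ V)) ∘L fnG V m x ∘L ampl m (inrL ℂ (spM₁ V))

/-- The linear fractional transform `G₁₁ + G₁₂ Θ (I - G₂₂ Θ)⁻¹ G₂₁`. -/
def lft (Θ : OpGraded d (spM₂ V) (spM₁ V)) : OpGraded d ℂ ℂ := fun m x =>
  fnG₁₁ V m x + fnG₁₂ V m x ∘L Θ m x ∘L Ring.inverse (1 - fnG₂₂ V m x ∘L Θ m x) ∘L fnG₂₁ V m x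

end Pick

end FreePick

end

noncomputable section

set_option linter.unusedSectionVars false

namespace FreePick

/-! ### Entrywise formulas and norms -/

section Basic

variable {H K : Type} [NormedAddCommGroup H] [InnerProductSpace ℂ H]
  [NormedAddCommGroup K] [InnerProductSpace ℂ K]

/-! The value `b = G(x)a` of a transfer function is encoded by the system U(a, δ(x)w) = (b, w) with
state w (`SystemEq`). Since U is a contraction, ‖b‖² + ‖w‖² ≤ ‖a‖² + ‖δ(x)w‖². Together with ‖δ(x)‖
< 1 this gives both invertibility claims (`isUnit_pencil`, `fnG₂₂_norm_lt`). The linear fractional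
transform closes the loop m₁ = Θm₂ (`lft_apply_eq`). At Λ the system is solved by vectors of N₂,
where U acts as V and the loop carries the signal 0, so every Θ interpolates (`lft_interpolates`).

For the other direction, a solution φ must be realized. An nc-function commutes with all rectangular
intertwiners (`IsNC.intertwine`). Given finitely many points of G_δ, Λ among them, free polynomials
restricted to these points form a finite-dimensional space on which multiplication by the variables
is again a point T of G_δ, with the constant 1 as distinguished vector e (`exists_common_point`).
Contractivity of φ at the points BTB⁻¹ of G_δ, dualized by Hahn-Banach, yields a Gram identity for e
and φ(T)e (`rankOne_mem_steinCone`, `exists_cyclic_model`), hence an isometric colligation;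
intertwiners carry its system from T to each of the given points.

The size of this colligation grows with the set of points. Its state is therefore split into a part
that carries the values at Λ, whose dimension depends only on n and J, and a part vanishing at Λ.
Only the second part is eliminated, which leaves a contractive nc-function Ξ on a fixed
finite-dimensional space (`exists_partial_realization`). An ultrafilter limit over all finite sets
of points then gives Ξ on the whole of G_δ (`exists_realization`).

Finally, Ξ(x) acts as I ⊗ V on ℂ^m ⊗ N₂. A contraction that is isometric on a subspace sends its
orthogonal complement into that of the image, so Ξ = (I ⊗ V) ⊕ Θ with Θ the compression of Ξ
(`exists_compress_split`). With this Θ the system of Ξ becomes the closed loop of U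
(`exists_parameter`). -/

theorem tensId_apply {m k : ℕ} (A : Matrix (Fin m) (Fin k) ℂ) (v : Tens k H) (i : Fin m) :
    tensId H A v i = ∑ j, A i j • v j := by
  simp [tensId]

theorem ampl_apply (m : ℕ) (T : H →L[ℂ] K) (v : Tens m H) (i : Fin m) :
    ampl m T v i = T (v i) := by
  simp only [ampl, blockOp_apply]
  rw [Finset.sum_eq_single i] <;> simp +contextual [eq_comm]

theorem deltaOp_apply {d J m : ℕ} (δ : PolyMat d J) (x : Tup d m) (v : Tens m (Tens J H))
    (i : Fin m) (a : Fin J) :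
    deltaOp δ x H v i a = ∑ j, ∑ b, polyEval (δ a b) x i j • v j b := by
  simp [deltaOp]

theorem tens_norm_sq {m : ℕ} (v : Tens m H) : ‖v‖ ^ 2 = ∑ i, ‖v i‖ ^ 2 :=
  PiLp.norm_sq_eq_of_L2 _ v

theorem tens_inner {m : ℕ} (v w : Tens m H) :
    inner ℂ v w = ∑ i, inner ℂ (v i) (w i) :=
  PiLp.inner_apply v w

theorem tensId_mul {m k l : ℕ} (A : Matrix (Fin m) (Fin k) ℂ) (B : Matrix (Fin k) (Fin l) ℂ)
    (v : Tens l H) : tensId H (A * B) v = tensId H A (tensId H B v) := by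
  ext i
  simp only [tensId_apply, Matrix.mul_apply, Finset.sum_smul, Finset.smul_sum, smul_smul]
  exact Finset.sum_comm

@[simp] theorem tensId_one {m : ℕ} (v : Tens m H) :
    tensId H (1 : Matrix (Fin m) (Fin m) ℂ) v = v := by
  ext i
  simp [tensId_apply, Matrix.one_apply]

theorem ampl_tensId {m k : ℕ} (T : H →L[ℂ] K) (A : Matrix (Fin m) (Fin k) ℂ) (v : Tens k H) :
    ampl m T (tensId H A v) = tensId K A (ampl k T v) := by
  ext i
  simp [tensId_apply, ampl_apply]

theorem ampl_norm_le {m : ℕ} {T : H →L[ℂ] K} (hT : ∀ h, ‖T h‖ ≤ ‖h‖) (v : Tens m H) :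
    ‖ampl m T v‖ ≤ ‖v‖ := by
  rw [← sq_le_sq₀ (norm_nonneg _) (norm_nonneg _), tens_norm_sq, tens_norm_sq]
  gcongr with i
  rw [ampl_apply]
  exact hT _

end Basic

/-! ### Evaluation of free polynomials and intertwining matrices -/

section Intertwining

variable {d J m k : ℕ}

/-- Rectangular B covers similarities, projections onto direct summands and the maps from a cyclic
point to the given points all at once. -/
theorem polyEval_intertwine {x : Tup d m} {y : Tup d k} {B : Matrix (Fin m) (Fin k) ℂ}
    (h : ∀ r, x r * B = B * y r) (p : Poly d) : polyEval p x * B = B * polyEval p y := by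
  unfold polyEval
  induction p using FreeAlgebra.induction with
  | grade0 c =>
    simp only [AlgHom.commutes, Matrix.algebraMap_eq_diagonal, Pi.algebraMap_def]
    ext i j
    simp [mul_comm]
  | grade1 r => simpa using h r
  | mul p q hp hq =>
    rw [map_mul, map_mul, Matrix.mul_assoc, hq, ← Matrix.mul_assoc, hp, Matrix.mul_assoc]
  | add p q hp hq => rw [map_add, map_add, Matrix.add_mul, hp, hq, Matrix.mul_add]

variable {H : Type} [NormedAddCommGroup H] [InnerProductSpace ℂ H]

theorem deltaOp_intertwine (δ : PolyMat d J) {x : Tup d m} {y : Tup d k}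
    {B : Matrix (Fin m) (Fin k) ℂ} (h : ∀ r, x r * B = B * y r) (v : Tens k (Tens J H)) :
    deltaOp δ x H (tensId (Tens J H) B v) = tensId (Tens J H) B (deltaOp δ y H v) := by
  ext i a
  have key : ∀ (b : Fin J) (t : Fin k), ∑ j, polyEval (δ a b) x i j * B j t =
      ∑ j, B i j * polyEval (δ a b) y j t := fun b t => by
    simpa [Matrix.mul_apply] using congrFun (congrFun (polyEval_intertwine h (δ a b)) i) t
  simp only [deltaOp_apply, tensId_apply, WithLp.ofLp_sum, WithLp.ofLp_smul, Finset.sum_apply,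
    Pi.smul_apply, Finset.smul_sum, smul_smul]
  calc ∑ j, ∑ b, ∑ t, (polyEval (δ a b) x i j * B j t) • v t b
      = ∑ b, ∑ t, (∑ j, polyEval (δ a b) x i j * B j t) • v t b := by
        simp only [Finset.sum_smul]
        rw [Finset.sum_comm]
        exact Finset.sum_congr rfl fun b _ => Finset.sum_comm
    _ = ∑ b, ∑ t, (∑ j, B i j * polyEval (δ a b) y j t) • v t b := by simp only [key]
    _ = _ := by
        simp only [Finset.sum_smul]
        rw [Finset.sum_comm, Finset.sum_congr rfl fun t _ => Finset.sum_comm, Finset.sum_comm]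

/-- The norm of `δ(x) ⊗ id_L` is at most that of `δ(x)`. -/
theorem deltaOp_norm_le (δ : PolyMat d J) (x : Tup d m) {l : ℕ}
    (v : Tens m (Tens J (EuclideanSpace ℂ (Fin l)))) :
    ‖deltaOp δ x (EuclideanSpace ℂ (Fin l)) v‖ ≤ ‖deltaOp δ x ℂ‖ * ‖v‖ := by
  have split : ∀ w : Tens m (Tens J (EuclideanSpace ℂ (Fin l))), ‖w‖ ^ 2 =
      ∑ c, ‖(WithLp.toLp 2 fun i => WithLp.toLp 2 fun a => w i a c : Tens m (Tens J ℂ))‖ ^ 2 := by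
    intro w
    simp only [tens_norm_sq, EuclideanSpace.norm_sq_eq]
    rw [Finset.sum_comm]
    simp_rw [Finset.sum_comm (γ := Fin J)]
    rw [Finset.sum_comm]
  rw [← sq_le_sq₀ (norm_nonneg _) (by positivity), mul_pow, split, split, Finset.mul_sum]
  gcongr with c
  rw [← mul_pow]
  gcongr
  refine le_trans (le_of_eq ?_) (ContinuousLinearMap.le_opNorm _ _)
  congr 1
  ext i a
  simp [deltaOp_apply]

theorem deltaOp_norm_lt {δ : PolyMat d J} {x : Tup d m} (hx : x ∈ gdel δ m) {l : ℕ}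
    {v : Tens m (Tens J (EuclideanSpace ℂ (Fin l)))} (hv : v ≠ 0) :
    ‖deltaOp δ x (EuclideanSpace ℂ (Fin l)) v‖ < ‖v‖ :=
  (deltaOp_norm_le δ x v).trans_lt <| by
    have := norm_pos_iff.2 hv
    nlinarith [hx.2]

theorem deltaOp_norm_le_self {δ : PolyMat d J} {x : Tup d m} (hx : x ∈ gdel δ m) {l : ℕ}
    (v : Tens m (Tens J (EuclideanSpace ℂ (Fin l)))) :
    ‖deltaOp δ x (EuclideanSpace ℂ (Fin l)) v‖ ≤ ‖v‖ :=
  (deltaOp_norm_le δ x v).trans <| by nlinarith [hx.2, norm_nonneg v]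

end Intertwining

/-! ### Direct sums -/

section DirectSum

variable {d J m k : ℕ} {H : Type} [NormedAddCommGroup H] [InnerProductSpace ℂ H]

theorem castAdd_ne_natAdd (i : Fin m) (j : Fin k) : Fin.castAdd k i ≠ Fin.natAdd m j := by
  intro h
  have := congrArg Fin.val h
  simp at this
  omega

/-- The matrix of the inclusion `ℂ^m → ℂ^(m+k)`. -/
def inclFst (m k : ℕ) : Matrix (Fin (m + k)) (Fin m) ℂ :=
  fun i j => if i = Fin.castAdd k j then 1 else 0

/-- The matrix of the inclusion `ℂ^k → ℂ^(m+k)`. -/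
def inclSnd (m k : ℕ) : Matrix (Fin (m + k)) (Fin k) ℂ :=
  fun i j => if i = Fin.natAdd m j then 1 else 0

theorem fstPart_eq (v : Tens (m + k) H) : fstPart v = tensId H (inclFst m k).transpose v := by
  ext i
  simp [fstPart, tensId_apply, inclFst, ite_smul]

theorem sndPart_eq (v : Tens (m + k) H) : sndPart v = tensId H (inclSnd m k).transpose v := by
  ext i
  simp [sndPart, tensId_apply, inclSnd, ite_smul]

@[simp] theorem fstPart_apply (v : Tens (m + k) H) (i : Fin m) :
    fstPart v i = v (Fin.castAdd k i) := rfl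

@[simp] theorem sndPart_apply (v : Tens (m + k) H) (i : Fin k) :
    sndPart v i = v (Fin.natAdd m i) := rfl

theorem norm_sq_parts (v : Tens (m + k) H) : ‖v‖ ^ 2 = ‖fstPart v‖ ^ 2 + ‖sndPart v‖ ^ 2 := by
  simp only [tens_norm_sq, Fin.sum_univ_add, fstPart_apply, sndPart_apply]

/-- The vector `v ⊕ w`. -/
def joinParts (v : Tens m H) (w : Tens k H) : Tens (m + k) H :=
  WithLp.toLp 2 (Fin.addCases (fun i => v i) (fun i => w i))

@[simp] theorem fstPart_join (v : Tens m H) (w : Tens k H) : fstPart (joinParts v w) = v := by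
  ext i; simp [joinParts]

@[simp] theorem sndPart_join (v : Tens m H) (w : Tens k H) : sndPart (joinParts v w) = w := by
  ext i; simp [joinParts]

theorem dsum_ll (x : Tup d m) (y : Tup d k) (r : Fin d) (i j : Fin m) :
    dsum x y r (Fin.castAdd k i) (Fin.castAdd k j) = x r i j := by simp [dsum]

theorem dsum_lr (x : Tup d m) (y : Tup d k) (r : Fin d) (i : Fin m) (j : Fin k) :
    dsum x y r (Fin.castAdd k i) (Fin.natAdd m j) = 0 := by simp [dsum]

theorem dsum_rl (x : Tup d m) (y : Tup d k) (r : Fin d) (i : Fin k) (j : Fin m) :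
    dsum x y r (Fin.natAdd m i) (Fin.castAdd k j) = 0 := by simp [dsum]

theorem dsum_rr (x : Tup d m) (y : Tup d k) (r : Fin d) (i j : Fin k) :
    dsum x y r (Fin.natAdd m i) (Fin.natAdd m j) = y r i j := by simp [dsum]

theorem inclFst_transpose_mul_dsum (x : Tup d m) (y : Tup d k) (r : Fin d) :
    x r * (inclFst m k).transpose = (inclFst m k).transpose * dsum x y r := by
  ext i j
  refine Fin.addCases (fun j => ?_) (fun j => ?_) j
  · simp [Matrix.mul_apply, inclFst, dsum_ll]
  · simp [Matrix.mul_apply, inclFst, dsum_lr, (castAdd_ne_natAdd _ _).symm]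

theorem inclSnd_transpose_mul_dsum (x : Tup d m) (y : Tup d k) (r : Fin d) :
    y r * (inclSnd m k).transpose = (inclSnd m k).transpose * dsum x y r := by
  ext i j
  refine Fin.addCases (fun j => ?_) (fun j => ?_) j
  · simp [Matrix.mul_apply, inclSnd, dsum_rl, castAdd_ne_natAdd]
  · simp [Matrix.mul_apply, inclSnd, dsum_rr]

theorem fstPart_deltaOp (δ : PolyMat d J) (x : Tup d m) (y : Tup d k)
    (v : Tens (m + k) (Tens J H)) :
    fstPart (deltaOp δ (dsum x y) H v) = deltaOp δ x H (fstPart v) := by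
  rw [fstPart_eq, fstPart_eq, deltaOp_intertwine δ (inclFst_transpose_mul_dsum x y)]

theorem sndPart_deltaOp (δ : PolyMat d J) (x : Tup d m) (y : Tup d k)
    (v : Tens (m + k) (Tens J H)) :
    sndPart (deltaOp δ (dsum x y) H v) = deltaOp δ y H (sndPart v) := by
  rw [sndPart_eq, sndPart_eq, deltaOp_intertwine δ (inclSnd_transpose_mul_dsum x y)]

theorem gdel_dsum {δ : PolyMat d J} {x : Tup d m} {y : Tup d k} (hx : x ∈ gdel δ m)
    (hy : y ∈ gdel δ k) : dsum x y ∈ gdel δ (m + k) := by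
  refine ⟨Nat.add_pos_left hx.1 _, ?_⟩
  refine lt_of_le_of_lt (ContinuousLinearMap.opNorm_le_bound _
    (le_max_of_le_left (norm_nonneg (deltaOp δ x ℂ)) : 0 ≤ max _ ‖deltaOp δ y ℂ‖) fun v => ?_)
    (max_lt hx.2 hy.2)
  have h0 : 0 ≤ max ‖deltaOp δ x ℂ‖ ‖deltaOp δ y ℂ‖ := le_max_of_le_left (norm_nonneg _)
  rw [← sq_le_sq₀ (norm_nonneg _) (by positivity), mul_pow, norm_sq_parts, norm_sq_parts v,
    fstPart_deltaOp, sndPart_deltaOp, mul_add, ← mul_pow, ← mul_pow]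
  gcongr
  · exact (ContinuousLinearMap.le_opNorm _ _).trans (by gcongr; exact le_max_left _ _)
  · exact (ContinuousLinearMap.le_opNorm _ _).trans (by gcongr; exact le_max_right _ _)

/-- δ(x) is a compression of δ(x ⊕ y). This lets a neighbourhood of x ⊕ y serve as a common
neighbourhood of x and y. -/
theorem gdel_of_dsum_left {δ : PolyMat d J} {x : Tup d m} {y : Tup d k} (hm : 0 < m)
    (h : dsum x y ∈ gdel δ (m + k)) : x ∈ gdel δ m := by
  refine ⟨hm, lt_of_le_of_lt (ContinuousLinearMap.opNorm_le_bound _ (norm_nonneg _)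
    fun v => ?_) h.2⟩
  have h1 := fstPart_deltaOp δ x y (joinParts v 0)
  rw [fstPart_join] at h1
  rw [← h1]
  have h2 : ‖(joinParts v 0 : Tens (m + k) (Tens J ℂ))‖ = ‖v‖ := by
    rw [← sq_eq_sq₀ (norm_nonneg _) (norm_nonneg _), norm_sq_parts]; simp
  rw [← h2]
  refine le_trans ?_ (ContinuousLinearMap.le_opNorm _ _)
  rw [← sq_le_sq₀ (norm_nonneg _) (norm_nonneg _), norm_sq_parts (deltaOp δ (dsum x y) ℂ _)]
  nlinarith [sq_nonneg ‖sndPart (deltaOp δ (dsum x y) ℂ (joinParts v 0))‖]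

theorem gdel_of_dsum_right {δ : PolyMat d J} {x : Tup d m} {y : Tup d k} (hk : 0 < k)
    (h : dsum x y ∈ gdel δ (m + k)) : y ∈ gdel δ k := by
  refine ⟨hk, lt_of_le_of_lt (ContinuousLinearMap.opNorm_le_bound _ (norm_nonneg _)
    fun v => ?_) h.2⟩
  have h1 := sndPart_deltaOp δ x y (joinParts 0 v)
  rw [sndPart_join] at h1
  rw [← h1]
  have h2 : ‖(joinParts 0 v : Tens (m + k) (Tens J ℂ))‖ = ‖v‖ := by
    rw [← sq_eq_sq₀ (norm_nonneg _) (norm_nonneg _), norm_sq_parts]; simp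
  rw [← h2]
  refine le_trans ?_ (ContinuousLinearMap.le_opNorm _ _)
  rw [← sq_le_sq₀ (norm_nonneg _) (norm_nonneg _), norm_sq_parts (deltaOp δ (dsum x y) ℂ _)]
  nlinarith [sq_nonneg ‖fstPart (deltaOp δ (dsum x y) ℂ (joinParts 0 v))‖]

end DirectSum

/-! ### Free holomorphic functions are nc-functions -/

section FreeHolo

variable {d J : ℕ} {H K : Type} [NormedAddCommGroup H] [InnerProductSpace ℂ H]
  [NormedAddCommGroup K] [InnerProductSpace ℂ K]

/-- The definition is local, but G_δ is closed under direct sums: the set G_ε around x ⊕ y, or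
around x ⊕ s⁻¹xs, contains both summands, so the nc-laws on it relate their values. -/
theorem IsFreeHolo.isNC {δ : PolyMat d J} {Θ : OpGraded d H K} (h : IsFreeHolo (gdel δ) Θ) :
    IsNC (gdel δ) Θ := by
  constructor
  · intro m k x y hx hy hxy v
    obtain ⟨J', ε, -, hε, -, hnc, -⟩ := h _ _ hxy
    exact hnc.dsum x y (gdel_of_dsum_left hx.1 hε) (gdel_of_dsum_right hy.1 hε) hε v
  · intro m x s hx hs
    obtain ⟨J', ε, -, hε, -, hnc, -⟩ := h _ _ (gdel_dsum hx hs)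
    exact hnc.similar x s (gdel_of_dsum_left hx.1 hε) (gdel_of_dsum_right hx.1 hε)

theorem inBall_of_isNC {δ : PolyMat d J} (hJ : 0 < J) {Θ : OpGraded d H K}
    (h : IsNC (gdel δ) Θ) (hb : ∀ (m : ℕ) (x : Tup d m), x ∈ gdel δ m → ‖Θ m x‖ ≤ 1) : InBall (gdel δ) Θ :=
  ⟨fun _ _ hx => ⟨J, δ, hJ, hx, fun _ => subset_rfl, h, 1, hb⟩, hb⟩

/-- An nc-function respects intertwining matrices. -/
theorem IsNC.intertwine {δ : PolyMat d J} {Θ : OpGraded d H K} (h : IsNC (gdel δ) Θ)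
    {m k : ℕ} {x : Tup d m} {y : Tup d k} (hx : x ∈ gdel δ m) (hy : y ∈ gdel δ k)
    {L : Matrix (Fin m) (Fin k) ℂ} (hL : ∀ r, x r * L = L * y r) (v : Tens k H) :
    Θ m x (tensId H L v) = tensId K L (Θ k y v) := by
  -- N has L in its upper right corner and N² = 0. The relation xL = Ly says that x ⊕ y commutes
  -- with N, so conjugation by s = 1 + N fixes x ⊕ y and Θ(x ⊕ y) commutes with s. The upper right
  -- corner of that identity is the claim.
  let N : Matrix (Fin (m + k)) (Fin (m + k)) ℂ :=
    inclFst m k * L * (inclSnd m k).transpose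
  have hsf : (inclSnd m k).transpose * inclFst m k = 0 := by
    ext i j; simp [Matrix.mul_apply, inclFst, inclSnd, castAdd_ne_natAdd]
  have hss : (inclSnd m k).transpose * inclSnd m k = 1 := by
    ext i j; simp [Matrix.mul_apply, inclSnd, Matrix.one_apply, eq_comm]
  have hff : (inclFst m k).transpose * inclFst m k = 1 := by
    ext i j; simp [Matrix.mul_apply, inclFst, Matrix.one_apply, eq_comm]
  have hfs : (inclFst m k).transpose * inclSnd m k = 0 := by
    ext i j; simp [Matrix.mul_apply, inclFst, inclSnd, (castAdd_ne_natAdd (m := m) (k := k) _ _).symm]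
  have hN : N * N = 0 := by
    simp only [N, Matrix.mul_assoc]
    rw [← Matrix.mul_assoc (inclSnd m k).transpose, hsf]; simp
  let s : (Matrix (Fin (m + k)) (Fin (m + k)) ℂ)ˣ :=
    ⟨1 + N, 1 - N, by simp [add_mul, mul_sub, hN], by simp [sub_mul, mul_add, hN]⟩
  have hdF : ∀ r, FreePick.dsum x y r * inclFst m k = inclFst m k * x r := by
    intro r
    ext i j
    refine Fin.addCases (fun i => ?_) (fun i => ?_) i
    · simp [Matrix.mul_apply, inclFst, dsum_ll]
    · simp [Matrix.mul_apply, inclFst, dsum_rl, (castAdd_ne_natAdd (m := m) (k := k) _ _).symm]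
  have hcomm : ∀ r, FreePick.dsum x y r * N = N * FreePick.dsum x y r := by
    intro r
    simp only [N]
    rw [← Matrix.mul_assoc, ← Matrix.mul_assoc, hdF, Matrix.mul_assoc (inclFst m k), hL,
      Matrix.mul_assoc _ _ (FreePick.dsum x y r), ← inclSnd_transpose_mul_dsum]
    simp only [Matrix.mul_assoc]
  have hxy := gdel_dsum hx hy
  have hsim : (fun r => (↑s⁻¹ : Matrix (Fin (m + k)) (Fin (m + k)) ℂ) * FreePick.dsum x y r * s) =
      FreePick.dsum x y := by
    funext r
    change (1 - N) * FreePick.dsum x y r * (1 + N) = _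
    rw [mul_assoc, mul_add, hcomm r, mul_one]
    have : N * (N * FreePick.dsum x y r) = 0 := by rw [← mul_assoc, hN, zero_mul]
    simp [sub_mul, mul_add, this]
  have h1 := h.similar (FreePick.dsum x y) s hxy (by rw [hsim]; exact hxy)
  rw [hsim] at h1
  have h2 := fun w => congrArg (fun T => tensId K (1 + N) (T w)) h1
  simp only [ContinuousLinearMap.comp_apply] at h2
  have hs' : (1 + N) * (↑s⁻¹ : Matrix (Fin (m + k)) (Fin (m + k)) ℂ) = 1 := s.mul_inv
  have hs'' : (s : Matrix (Fin (m + k)) (Fin (m + k)) ℂ) = 1 + N := rfl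
  simp only [← tensId_mul, hs', hs'', tensId_one] at h2
  have h3 := congrArg fstPart (h2 (tensId H (inclSnd m k) v))
  rw [(h.dsum x y hx hy hxy _).1] at h3
  have e1 : (inclFst m k).transpose * ((1 + N) * inclSnd m k) = L := by
    simp only [N, hfs, Matrix.mul_assoc, hss, Matrix.mul_one, zero_add,
      Matrix.add_mul, Matrix.mul_add, Matrix.one_mul]
    rw [← Matrix.mul_assoc, hff, Matrix.one_mul]
  have e2 : (inclFst m k).transpose * (1 + N) =
      (inclFst m k).transpose + L * (inclSnd m k).transpose := by
    simp only [N, Matrix.mul_add, Matrix.mul_one, Matrix.mul_assoc]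
    rw [← Matrix.mul_assoc (inclFst m k).transpose, hff, Matrix.one_mul]
  have hadd : ∀ (A B : Matrix (Fin m) (Fin (m + k)) ℂ) (w : Tens (m + k) K),
      tensId K (A + B) w = tensId K A w + tensId K B w := by
    intro A B w; ext i; simp [tensId_apply, add_smul, Finset.sum_add_distrib]
  have hz : (tensId H (0 : Matrix (Fin m) (Fin k) ℂ) v) = 0 := by
    ext i; simp [tensId_apply]
  rw [fstPart_eq, fstPart_eq, ← tensId_mul, ← tensId_mul, ← tensId_mul,
    Matrix.mul_assoc _ (1 + N) (inclSnd m k), e1, e2, hadd,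
    ← fstPart_eq, tensId_mul L, ← sndPart_eq, (h.dsum x y hx hy hxy _).1,
    (h.dsum x y hx hy hxy _).2, fstPart_eq, sndPart_eq, ← tensId_mul, ← tensId_mul, hfs, hss,
    hz, map_zero, zero_add, tensId_one] at h3
  exact h3.symm

/-- A function respecting intertwining matrices is an nc-function. -/
theorem isNC_of_intertwine {δ : PolyMat d J} {Θ : OpGraded d H K}
    (h : ∀ {m k : ℕ} {x : Tup d m} {y : Tup d k}, x ∈ gdel δ m → y ∈ gdel δ k →
      ∀ {L : Matrix (Fin m) (Fin k) ℂ}, (∀ r, x r * L = L * y r) → ∀ v : Tens k H,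
        Θ m x (tensId H L v) = tensId K L (Θ k y v)) : IsNC (gdel δ) Θ := by
  constructor
  · intro m k x y hx hy hxy v
    rw [fstPart_eq, fstPart_eq, sndPart_eq, sndPart_eq]
    exact ⟨(h hx hxy (inclFst_transpose_mul_dsum x y) v).symm,
      (h hy hxy (inclSnd_transpose_mul_dsum x y) v).symm⟩
  · intro m x s hx hs
    ext1 v
    have h1 := h hs hx (L := (↑s⁻¹ : Matrix (Fin m) (Fin m) ℂ))
      (fun r => by rw [Matrix.mul_assoc, Matrix.mul_assoc, s.mul_inv, Matrix.mul_one])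
      (tensId H (s : Matrix (Fin m) (Fin m) ℂ) v)
    rw [← tensId_mul, s.inv_mul, tensId_one] at h1
    exact h1

end FreeHolo

/-! ### Transfer functions of contractions -/

theorem isUnit_of_injective {E : Type} [NormedAddCommGroup E] [InnerProductSpace ℂ E]
    [FiniteDimensional ℂ E] (T : E →L[ℂ] E) (h : ∀ v, T v = 0 → v = 0) : IsUnit T := by
  have : CompleteSpace E := FiniteDimensional.complete ℂ E
  have hi : Function.Injective T := (injective_iff_map_eq_zero T).2 h
  exact ContinuousLinearMap.isUnit_iff_bijective.2
    ⟨hi, (LinearMap.injective_iff_surjective (f := (T : E →ₗ[ℂ] E))).1 hi⟩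

section Transfer

variable {E F : Type} [NormedAddCommGroup E] [InnerProductSpace ℂ E]
  [NormedAddCommGroup F] [InnerProductSpace ℂ F] {d J m k : ℕ}

theorem hsum_norm_sq (z : HSum E F) : ‖z‖ ^ 2 = ‖z.fst‖ ^ 2 + ‖z.snd‖ ^ 2 :=
  WithLp.prod_norm_sq_eq_of_L2 z

theorem hsum_ext {z w : HSum E F} (h₁ : z.fst = w.fst) (h₂ : z.snd = w.snd) : z = w :=
  WithLp.ofLp_injective 2 (Prod.ext h₁ h₂)

theorem inlL_apply (e : E) : inlL E F e = WithLp.toLp 2 (e, 0) := rfl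

theorem inrL_apply (f : F) : inrL E F f = WithLp.toLp 2 (0, f) := rfl

section

variable {L : Type} [NormedAddCommGroup L] [InnerProductSpace ℂ L]
  (δ : PolyMat d J) (U : HSum E (Tens J L) →L[ℂ] HSum F (Tens J L))

theorem blocks_fst (a : E) (w : Tens J L) :
    (U (WithLp.toLp 2 (a, w))).fst = blockA U a + blockB U w := by
  have : (WithLp.toLp 2 (a, w) : HSum E (Tens J L)) = inlL _ _ a + inrL _ _ w :=
    hsum_ext (by simp [inlL_apply, inrL_apply]) (by simp [inlL_apply, inrL_apply])
  rw [this, map_add]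
  rfl

theorem blocks_snd (a : E) (w : Tens J L) :
    (U (WithLp.toLp 2 (a, w))).snd = blockC U a + blockD U w := by
  have : (WithLp.toLp 2 (a, w) : HSum E (Tens J L)) = inlL _ _ a + inrL _ _ w :=
    hsum_ext (by simp [inlL_apply, inrL_apply]) (by simp [inlL_apply, inrL_apply])
  rw [this, map_add]
  rfl

/-- The input `a`, the state `w` and the output `b` satisfy the equations of the linear system
with colligation `U` at the point `x`. -/
def SystemEq (x : Tup d m) (a : Tens m E) (w : Tens m (Tens J L)) (b : Tens m F) : Prop :=
  ∀ i, U (WithLp.toLp 2 (a i, deltaOp δ x L w i)) = WithLp.toLp 2 (b i, w i)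

variable {δ U}

/-- U acts on the second tensor factor and B on the first, while δ respects intertwiners. This is
what makes transfer functions nc and what transports a realization from one point to another. -/
theorem SystemEq.intertwine {x : Tup d m} {y : Tup d k} {B : Matrix (Fin m) (Fin k) ℂ}
    (hB : ∀ r, x r * B = B * y r) {a : Tens k E} {w : Tens k (Tens J L)} {b : Tens k F}
    (h : SystemEq δ U y a w b) :
    SystemEq δ U x (tensId E B a) (tensId _ B w) (tensId F B b) := by
  intro i
  rw [deltaOp_intertwine δ hB]
  have e1 : (WithLp.toLp 2 (tensId E B a i, tensId (Tens J L) B (deltaOp δ y L w) i) :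
      HSum E (Tens J L)) = ∑ j, B i j • WithLp.toLp 2 (a j, deltaOp δ y L w j) := by
    refine hsum_ext ?_ ?_
    · rw [← WithLp.fstL_apply (𝕜 := ℂ) 2, ← WithLp.fstL_apply (𝕜 := ℂ) 2, map_sum]
      simp [tensId_apply]
    · rw [← WithLp.sndL_apply (𝕜 := ℂ) 2, ← WithLp.sndL_apply (𝕜 := ℂ) 2, map_sum]
      simp [tensId_apply]
  rw [e1, map_sum]
  simp only [map_smul, h _]
  refine hsum_ext ?_ ?_
  · rw [← WithLp.fstL_apply (𝕜 := ℂ) 2, ← WithLp.fstL_apply (𝕜 := ℂ) 2, map_sum]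
    simp [tensId_apply]
  · rw [← WithLp.sndL_apply (𝕜 := ℂ) 2, ← WithLp.sndL_apply (𝕜 := ℂ) 2, map_sum]
    simp [tensId_apply]

theorem SystemEq.state_eq {x : Tup d m} {a : Tens m E} {w : Tens m (Tens J L)} {b : Tens m F}
    (h : SystemEq δ U x a w b) : pencil δ U x w = ampl m (blockC U) a := by
  ext1 i
  have h1 := congrArg WithLp.snd (h i)
  rw [blocks_snd] at h1
  simp only [pencil, sub_apply, one_apply_eq_self,
    ContinuousLinearMap.comp_apply, PiLp.sub_apply, ampl_apply]
  rw [sub_eq_iff_eq_add]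
  exact h1.symm

/-- The state is determined by the input once the pencil is invertible, so any solution of the
system reveals the value of the transfer function without computing inverses. -/
theorem SystemEq.transfer_eq {x : Tup d m} (hx : IsUnit (pencil δ U x)) {a : Tens m E}
    {w : Tens m (Tens J L)} {b : Tens m F} (h : SystemEq δ U x a w b) :
    transfer δ U m x a = b := by
  have hw : Ring.inverse (pencil δ U x) (ampl m (blockC U) a) = w := by
    rw [← h.state_eq, ← mul_apply_eq_comp, Ring.inverse_mul_cancel _ hx]; rfl
  ext1 i
  have h1 := congrArg WithLp.fst (h i)
  rw [blocks_fst] at h1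
  simp only [transfer, add_apply, ContinuousLinearMap.comp_apply, hw,
    PiLp.add_apply, ampl_apply]
  exact h1

theorem exists_systemEq {x : Tup d m} (hx : IsUnit (pencil δ U x)) (a : Tens m E) :
    ∃ w, SystemEq δ U x a w (transfer δ U m x a) := by
  refine ⟨Ring.inverse (pencil δ U x) (ampl m (blockC U) a), fun i => ?_⟩
  have hw : pencil δ U x (Ring.inverse (pencil δ U x) (ampl m (blockC U) a)) =
      ampl m (blockC U) a := by
    rw [← mul_apply_eq_comp, Ring.mul_inverse_cancel _ hx]; rfl
  refine hsum_ext ?_ ?_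
  · rw [blocks_fst]
    simp [transfer, ampl_apply]
  · rw [blocks_snd]
    have h1 := congrArg (fun z : Tens m (Tens J L) => z i) hw
    simp only [pencil, sub_apply, one_apply_eq_self,
      ContinuousLinearMap.comp_apply, PiLp.sub_apply, ampl_apply] at h1
    rw [sub_eq_iff_eq_add] at h1
    exact h1.symm

end

/-! ### Energy balance for contractive colligations -/

section Contraction

variable {l : ℕ} {δ : PolyMat d J}
  {U : HSum E (Tens J (EuclideanSpace ℂ (Fin l))) →L[ℂ] HSum F (Tens J (EuclideanSpace ℂ (Fin l)))}

theorem SystemEq.norm_sq_le (hU : ∀ z, ‖U z‖ ≤ ‖z‖) {x : Tup d m} {a : Tens m E}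
    {w : Tens m (Tens J (EuclideanSpace ℂ (Fin l)))} {b : Tens m F} (h : SystemEq δ U x a w b) :
    ‖b‖ ^ 2 + ‖w‖ ^ 2 ≤ ‖a‖ ^ 2 + ‖deltaOp δ x (EuclideanSpace ℂ (Fin l)) w‖ ^ 2 := by
  rw [tens_norm_sq b, tens_norm_sq w, tens_norm_sq a, tens_norm_sq (deltaOp _ _ _ _),
    ← Finset.sum_add_distrib, ← Finset.sum_add_distrib]
  refine Finset.sum_le_sum fun i _ => ?_
  have := pow_le_pow_left₀ (norm_nonneg _) (hU (WithLp.toLp 2 (a i, deltaOp δ x _ w i))) 2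
  rw [h i, hsum_norm_sq, hsum_norm_sq] at this
  exact this

/-- A kernel vector satisfies w = (I ⊗ D)δ(x)w, which is impossible for w ≠ 0 because D is a
contraction and δ(x) strictly decreases norms. -/
theorem isUnit_pencil (hU : ∀ z, ‖U z‖ ≤ ‖z‖) {x : Tup d m} (hx : x ∈ gdel δ m) :
    IsUnit (pencil δ U x) := by
  refine isUnit_of_injective _ fun w hw => ?_
  by_contra hne
  simp only [pencil, sub_apply, one_apply_eq_self,
    ContinuousLinearMap.comp_apply, sub_eq_zero] at hw
  have h1 := deltaOp_norm_lt hx hne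
  have h2 : ‖ampl m (blockD U) (deltaOp δ x _ w)‖ ≤ ‖deltaOp δ x _ w‖ := by
    refine ampl_norm_le (fun z => ?_) _
    have := hU (inrL _ _ z)
    have e1 : ‖(inrL E _ z)‖ = ‖z‖ := by simp [inrL_apply]
    rw [e1] at this
    refine le_trans ?_ this
    rw [← sq_le_sq₀ (norm_nonneg _) (norm_nonneg _), hsum_norm_sq (U _)]
    have : (U (inrL E _ z)).snd = blockD U z := rfl
    rw [this]
    nlinarith [sq_nonneg ‖(U (inrL E _ z)).fst‖]
  rw [← hw] at h2
  exact absurd h2 (not_le.2 h1)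

theorem transfer_norm_le (hU : ∀ z, ‖U z‖ ≤ ‖z‖) {x : Tup d m} (hx : x ∈ gdel δ m) :
    ‖transfer δ U m x‖ ≤ 1 := by
  refine ContinuousLinearMap.opNorm_le_bound _ zero_le_one fun a => ?_
  obtain ⟨w, hw⟩ := exists_systemEq (isUnit_pencil hU hx) a
  have h1 := hw.norm_sq_le hU
  have h2 := pow_le_pow_left₀ (norm_nonneg _) (deltaOp_norm_le_self hx w) 2
  rw [one_mul, ← sq_le_sq₀ (norm_nonneg _) (norm_nonneg _)]
  linarith

theorem transfer_isNC (hU : ∀ z, ‖U z‖ ≤ ‖z‖) : IsNC (gdel δ) (transfer δ U) := by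
  refine isNC_of_intertwine fun hx hy L hL v => ?_
  obtain ⟨w, hw⟩ := exists_systemEq (isUnit_pencil hU hy) v
  exact (hw.intertwine hL).transfer_eq (isUnit_pencil hU hx)

end Contraction

end Transfer

/-! ### A convex cone of Stein differences -/

section Stein

open scoped ComplexOrder

variable {k J : ℕ} (D : Matrix (Fin k × Fin J) (Fin k × Fin J) ℂ)

/-- The partial trace over `ℂ^J` of `K - D K D*`. -/
def stein : Matrix (Fin k × Fin J) (Fin k × Fin J) ℂ →ₗ[ℂ] (Fin k → Fin k → ℂ) where
  toFun K s t := ∑ a, (K - D * K * D.conjTranspose) (s, a) (t, a)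
  map_add' K K' := by
    funext s t
    simp only [Matrix.mul_add, Matrix.add_mul, Matrix.sub_apply, Matrix.add_apply, Pi.add_apply,
      ← Finset.sum_add_distrib]
    exact Finset.sum_congr rfl fun _ _ => by ring
  map_smul' c K := by
    funext s t
    simp only [Matrix.mul_smul, Matrix.smul_mul, Matrix.sub_apply, Matrix.smul_apply,
      Pi.smul_apply, ← smul_sub, ← Finset.smul_sum, RingHom.id_apply]

/-- The cone of the matrices `stein D K`, with `K` positive semidefinite. -/
def steinCone : Set (Fin k → Fin k → ℂ) := stein D '' {K | K.PosSemidef}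

variable {D}

theorem exists_factor {ι : Type} [Fintype ι] [DecidableEq ι] {K : Matrix ι ι ℂ}
    (hK : K.PosSemidef) : ∃ M : Matrix ι ι ℂ, M * M.conjTranspose = K := by
  open scoped MatrixOrder Matrix.Norms.L2Operator in
  obtain ⟨B, hB⟩ := CStarAlgebra.nonneg_iff_eq_star_mul_self.mp hK.nonneg
  exact ⟨B.conjTranspose, by rw [hB, Matrix.conjTranspose_conjTranspose]; rfl⟩

theorem diag_mul_conjTranspose {ι κ : Type} [Fintype κ] (M : Matrix ι κ ℂ) (i : ι) :
    ((M * M.conjTranspose) i i).re = ∑ c, ‖M i c‖ ^ 2 := by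
  rw [Matrix.mul_apply, Complex.re_sum]
  refine Finset.sum_congr rfl fun c _ => ?_
  rw [Matrix.conjTranspose_apply, Complex.star_def, Complex.mul_conj, Complex.ofReal_re,
    Complex.normSq_eq_norm_sq]

/-- Coercivity: tr(K - DKD*) ≥ (1 - r²) tr K for K = MM*. The image under `stein` thus controls the
size of the factor M. -/
theorem stein_trace_ge {r : ℝ}
    (hD : ∀ v : Fin k × Fin J → ℂ, ∑ i, ‖D.mulVec v i‖ ^ 2 ≤ r ^ 2 * ∑ i, ‖v i‖ ^ 2)
    (M : Matrix (Fin k × Fin J) (Fin k × Fin J) ℂ) :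
    (1 - r ^ 2) * ∑ i, ∑ c, ‖M i c‖ ^ 2 ≤
      (∑ s, stein D (M * M.conjTranspose) s s).re := by
  have h1 : D * (M * M.conjTranspose) * D.conjTranspose = (D * M) * (D * M).conjTranspose := by
    rw [Matrix.conjTranspose_mul]; simp only [Matrix.mul_assoc]
  have h2 : (∑ s, stein D (M * M.conjTranspose) s s).re =
      ∑ i, ∑ c, ‖M i c‖ ^ 2 - ∑ i, ∑ c, ‖(D * M) i c‖ ^ 2 := by
    simp only [stein, LinearMap.coe_mk, AddHom.coe_mk, h1, Complex.re_sum, Matrix.sub_apply,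
      Complex.sub_re, diag_mul_conjTranspose, Finset.sum_sub_distrib, Fintype.sum_prod_type]
  have h3 : ∑ i, ∑ c, ‖(D * M) i c‖ ^ 2 ≤ r ^ 2 * ∑ i, ∑ c, ‖M i c‖ ^ 2 := by
    rw [Finset.sum_comm, Finset.sum_comm (f := fun i c => ‖M i c‖ ^ 2), Finset.mul_sum]
    exact Finset.sum_le_sum fun c _ => hD fun i => M i c
  rw [h2]
  linarith

/-- A linear image of a closed cone need not be closed. Here coercivity bounds the preimages of a
convergent sequence, and a subsequence of them converges. -/
theorem isClosed_steinCone {r : ℝ} (hr : r ^ 2 < 1)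
    (hD : ∀ v : Fin k × Fin J → ℂ, ∑ i, ‖D.mulVec v i‖ ^ 2 ≤ r ^ 2 * ∑ i, ‖v i‖ ^ 2) :
    IsClosed (steinCone D) := by
  -- Writing K = MM* replaces the positivity constraint by a free matrix M.
  let Ψ : (Fin k × Fin J → Fin k × Fin J → ℂ) → (Fin k → Fin k → ℂ) :=
    fun M => stein D (Matrix.of M * (Matrix.of M).conjTranspose)
  have hΨ : Continuous Ψ := by
    refine continuous_pi fun s => continuous_pi fun t => ?_
    simp only [Ψ, stein, LinearMap.coe_mk, AddHom.coe_mk, Matrix.sub_apply, Matrix.mul_apply,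
      Matrix.conjTranspose_apply, Matrix.of_apply]
    fun_prop
  have hrange : steinCone D = Set.range Ψ := by
    ext h
    constructor
    · rintro ⟨K, hK, rfl⟩
      obtain ⟨M, rfl⟩ := exists_factor hK
      exact ⟨M, rfl⟩
    · rintro ⟨M, rfl⟩
      exact ⟨_, Matrix.posSemidef_self_mul_conjTranspose _, rfl⟩
  rw [hrange]
  refine IsSeqClosed.isClosed fun h h₀ hmem hlim => ?_
  choose M hM using hmem
  have htr : Continuous fun g : Fin k → Fin k → ℂ => (∑ s, g s s).re := by fun_prop
  obtain ⟨C, hC⟩ := ((htr.tendsto h₀).comp hlim).bddAbove_range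
  have hb : ∀ n, M n ∈ Metric.closedBall (0 : Fin k × Fin J → Fin k × Fin J → ℂ)
      (Real.sqrt (C / (1 - r ^ 2))) := by
    intro n
    have h1 := stein_trace_ge hD (Matrix.of (M n))
    have h2 : (∑ s, stein D (Matrix.of (M n) * (Matrix.of (M n)).conjTranspose) s s).re ≤ C := by
      have := hC ⟨n, rfl⟩
      simp only [Function.comp_apply, ← hM n] at this
      exact this
    have h3 : ∑ i, ∑ c, ‖M n i c‖ ^ 2 ≤ C / (1 - r ^ 2) := by
      rw [le_div_iff₀ (by linarith), mul_comm]
      exact h1.trans h2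
    rw [mem_closedBall_zero_iff, pi_norm_le_iff_of_nonneg (Real.sqrt_nonneg _)]
    intro i
    rw [pi_norm_le_iff_of_nonneg (Real.sqrt_nonneg _)]
    intro c
    refine Real.le_sqrt_of_sq_le (le_trans ?_ h3)
    refine le_trans ?_ (Finset.single_le_sum (f := fun i => ∑ c, ‖M n i c‖ ^ 2)
      (fun i _ => by positivity) (Finset.mem_univ i))
    exact Finset.single_le_sum (f := fun c => ‖M n i c‖ ^ 2)
      (fun i _ => by positivity) (Finset.mem_univ c)
  obtain ⟨M₀, -, θ, hθ, hlimM⟩ := tendsto_subseq_of_bounded Metric.isBounded_closedBall hb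
  refine ⟨M₀, tendsto_nhds_unique ((hΨ.tendsto M₀).comp hlimM) ?_⟩
  have := hlim.comp hθ.tendsto_atTop
  refine this.congr fun n => ?_
  simp [hM]

theorem convex_steinCone : Convex ℝ (steinCone D) := by
  rintro _ ⟨K, hK, rfl⟩ _ ⟨K', hK', rfl⟩ a b ha hb -
  refine ⟨(a : ℂ) • K + (b : ℂ) • K', ?_, ?_⟩
  · refine Matrix.PosSemidef.add ?_ ?_
    · exact Matrix.PosSemidef.smul hK (by exact_mod_cast ha)
    · exact Matrix.PosSemidef.smul hK' (by exact_mod_cast hb)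
  · rw [map_add, map_smul, map_smul]
    simp only [Complex.coe_smul]

/-- A matrix outside the cone is separated from it by a functional. -/
theorem exists_separating {r : ℝ} (hr : r ^ 2 < 1)
    (hD : ∀ v : Fin k × Fin J → ℂ, ∑ i, ‖D.mulVec v i‖ ^ 2 ≤ r ^ 2 * ∑ i, ‖v i‖ ^ 2)
    {h : Fin k → Fin k → ℂ} (hh : h ∉ steinCone D) :
    ∃ f : (Fin k → Fin k → ℂ) →L[ℝ] ℝ, f h < 0 ∧
      ∀ K : Matrix (Fin k × Fin J) (Fin k × Fin J) ℂ, K.PosSemidef → 0 ≤ f (stein D K) := by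
  obtain ⟨f, u, hu, hf⟩ := geometric_hahn_banach_point_closed (convex_steinCone (D := D))
    (isClosed_steinCone hr hD) hh
  have h0 : u < 0 := by
    simpa using hf 0 ⟨0, Matrix.PosSemidef.zero, map_zero _⟩
  refine ⟨f, hu.trans h0, fun K hK => ?_⟩
  by_contra! hneg
  -- If f were negative on the ray through K, this nonnegative multiple of K would give f exactly
  -- the value u, whereas f > u on the cone.
  have hc : 0 ≤ u / f (stein D K) := div_nonneg_of_nonpos h0.le hneg.le
  have h1 := hf (stein D (((u / f (stein D K) : ℝ) : ℂ) • K))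
    ⟨_, Matrix.PosSemidef.smul hK (by exact_mod_cast hc), rfl⟩
  rw [map_smul, Complex.coe_smul, map_smul, smul_eq_mul, div_mul_cancel₀ _ hneg.ne] at h1
  exact lt_irrefl _ h1

/-- A real functional on matrices is represented on rank one matrices by a hermitian form. -/
theorem exists_hermitian_form (f : (Fin k → Fin k → ℂ) →L[ℝ] ℝ) :
    ∃ R : Matrix (Fin k) (Fin k) ℂ, R.IsHermitian ∧ ∀ v : Fin k → ℂ,
      dotProduct (star v) (R.mulVec v) = (f (fun s t => v s * star (v t)) : ℂ) := by
  -- The complex-linear functional with real part f. The hermitian part of its coefficient matrix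
  -- represents f on the matrices vv*.
  let g : (Fin k → Fin k → ℂ) → ℂ := fun X => (f X : ℂ) - Complex.I * (f (Complex.I • X) : ℂ)
  have gadd : ∀ X Y, g (X + Y) = g X + g Y := by
    intro X Y; simp only [g, smul_add, map_add, Complex.ofReal_add]; ring
  have gsmul : ∀ (c : ℂ) X, g (c • X) = c * g X := by
    intro c X
    have e1 : c • X = c.re • X + c.im • (Complex.I • X) := by
      conv_lhs => rw [← Complex.re_add_im c]
      rw [add_smul, mul_smul, Complex.coe_smul, Complex.coe_smul]
    have e2 : Complex.I • c • X = c.re • (Complex.I • X) - c.im • X := by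
      rw [e1, smul_add, smul_comm, smul_comm Complex.I c.im, smul_smul Complex.I,
        Complex.I_mul_I, neg_one_smul, smul_neg, sub_eq_add_neg]
    simp only [g]
    rw [e2, e1]
    simp only [map_add, map_sub, map_smul, smul_eq_mul, Complex.ofReal_add, Complex.ofReal_sub,
      Complex.ofReal_mul]
    conv_rhs => rw [← Complex.re_add_im c]
    linear_combination (c.im : ℂ) * (f (Complex.I • X) : ℂ) * Complex.I_mul_I
  let gl : (Fin k → Fin k → ℂ) →ₗ[ℂ] ℂ := ⟨⟨g, gadd⟩, gsmul⟩
  let E : Fin k → Fin k → (Fin k → Fin k → ℂ) := fun s t => Pi.single s (Pi.single t 1)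
  have hexp : ∀ X : Fin k → Fin k → ℂ, g X = ∑ s, ∑ t, X s t * g (E s t) := by
    intro X
    have : X = ∑ s, ∑ t, X s t • E s t := by
      funext s t
      simp [E, Finset.sum_apply, Pi.single_apply, Finset.sum_ite_eq, ite_apply]
    calc g X = gl (∑ s, ∑ t, X s t • E s t) := by rw [← this]; rfl
      _ = _ := by simp only [map_sum, map_smul, smul_eq_mul]; rfl
  refine ⟨Matrix.of fun t s => (g (E s t) + star (g (E t s))) / 2, ?_, fun v => ?_⟩
  · ext s t
    simp only [Matrix.conjTranspose_apply, Matrix.of_apply, star_div₀, star_add, star_star, star_ofNat]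
    ring
  · have hg := hexp (fun s t => v s * star (v t))
    have hg' : star (g fun s t => v s * star (v t)) =
        ∑ s, ∑ t, v t * star (v s) * star (g (E s t)) := by
      rw [hg, star_sum]
      refine Finset.sum_congr rfl fun s _ => ?_
      rw [star_sum]
      exact Finset.sum_congr rfl fun t _ => by simp [mul_comm]
    have hre : (f (fun s t => v s * star (v t)) : ℂ) = (g (fun s t => v s * star (v t)) +
        star (g (fun s t => v s * star (v t)))) / 2 := by
      simp only [g, star_sub, star_mul', Complex.star_def, Complex.conj_ofReal, Complex.conj_I]
      ring
    rw [hre, hg', hg, Finset.sum_comm]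
    simp only [dotProduct, Matrix.mulVec, Matrix.of_apply, Pi.star_apply, Finset.mul_sum,
      ← Finset.sum_add_distrib, Finset.sum_div]
    refine Finset.sum_congr rfl fun t _ => Finset.sum_congr rfl fun s _ => ?_
    ring

end Stein

/-! ### A model at a cyclic point -/

/-- A form that strictly decreases along a strict contraction is positive. -/
theorem le_of_stein {V : Type} [NormedAddCommGroup V] {D : V → V} {q : V → ℝ} {r M c : ℝ}
    (hr0 : 0 ≤ r) (hr : r < 1) (hM : 0 ≤ M) (hc : 0 ≤ c) (hD : ∀ v, ‖D v‖ ≤ r * ‖v‖)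
    (hq : ∀ v, -(M * ‖v‖ ^ 2) ≤ q v) (h : ∀ v, q (D v) + c * ‖v‖ ^ 2 ≤ q v) (v : V) :
    c * ‖v‖ ^ 2 ≤ q v := by
  -- Iterating the hypothesis gives q(v) ≥ q(Dⁿv) ≥ -M r²ⁿ‖v‖², which tends to 0. Hence q ≥ 0, and
  -- one more application of the hypothesis gives the bound.
  have h1 : ∀ (n : ℕ) (v : V), -(M * (r ^ n) ^ 2 * ‖v‖ ^ 2) ≤ q v := by
    intro n
    induction n with
    | zero => intro v; simpa using hq v
    | succ n ih =>
      intro v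
      have e1 := ih (D v)
      have e2 : ‖D v‖ ^ 2 ≤ (r * ‖v‖) ^ 2 := pow_le_pow_left₀ (norm_nonneg _) (hD v) 2
      have e3 : M * (r ^ n) ^ 2 * ‖D v‖ ^ 2 ≤ M * (r ^ n) ^ 2 * (r * ‖v‖) ^ 2 := by gcongr
      have e4 : M * (r ^ n) ^ 2 * (r * ‖v‖) ^ 2 = M * (r ^ (n + 1)) ^ 2 * ‖v‖ ^ 2 := by ring
      have e5 : 0 ≤ c * ‖v‖ ^ 2 := by positivity
      linarith [h v]
  have h2 : ∀ v, 0 ≤ q v := by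
    intro v
    have t := tendsto_pow_atTop_nhds_zero_of_lt_one hr0 hr
    have t2 : Filter.Tendsto (fun n : ℕ => -(M * (r ^ n) ^ 2 * ‖v‖ ^ 2)) Filter.atTop
        (nhds (-(M * 0 ^ 2 * ‖v‖ ^ 2))) := (((t.pow 2).const_mul M).mul_const _).neg
    simpa using le_of_tendsto' t2 fun n => h1 n v
  linarith [h v, h2 (D v)]

section Cyclic

variable {d J k : ℕ}

/-- The matrix of `δ(T)`, with rows and columns indexed by `Fin k × Fin J`. -/
def deltaMat (δ : PolyMat d J) (T : Tup d k) : Matrix (Fin k × Fin J) (Fin k × Fin J) ℂ :=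
  Matrix.of fun i j => polyEval (δ i.2 j.2) T i.1 j.1

/-- A vector indexed by `Fin k × Fin J`, as a vector of `ℂ^k ⊗ ℂ^J`. -/
def toTens (v : Fin k × Fin J → ℂ) : Tens k (Tens J ℂ) :=
  WithLp.toLp 2 fun s => WithLp.toLp 2 fun a => v (s, a)

theorem norm_sq_toTens (v : Fin k × Fin J → ℂ) : ‖toTens v‖ ^ 2 = ∑ i, ‖v i‖ ^ 2 := by
  simp only [tens_norm_sq, Fintype.sum_prod_type]
  rfl

theorem deltaOp_toTens (δ : PolyMat d J) (T : Tup d k) (v : Fin k × Fin J → ℂ) :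
    deltaOp δ T ℂ (toTens v) = toTens ((deltaMat δ T).mulVec v) := by
  ext s a
  rw [deltaOp_apply]
  simp [toTens, deltaMat, Matrix.mulVec, dotProduct, Fintype.sum_prod_type]

theorem deltaMat_bound (δ : PolyMat d J) (T : Tup d k) (v : Fin k × Fin J → ℂ) :
    ∑ i, ‖(deltaMat δ T).mulVec v i‖ ^ 2 ≤ ‖deltaOp δ T ℂ‖ ^ 2 * ∑ i, ‖v i‖ ^ 2 := by
  rw [← norm_sq_toTens, ← norm_sq_toTens, ← deltaOp_toTens, ← mul_pow]
  gcongr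
  exact ContinuousLinearMap.le_opNorm _ _

theorem stein_rankOne (D : Matrix (Fin k × Fin J) (Fin k × Fin J) ℂ) (v : Fin k × Fin J → ℂ) :
    stein D (Matrix.vecMulVec v (star v)) =
      (∑ a, fun s t => v (s, a) * star (v (t, a))) -
        ∑ a, fun s t => D.mulVec v (s, a) * star (D.mulVec v (t, a)) := by
  funext s t
  have : D * Matrix.vecMulVec v (star v) * D.conjTranspose =
      Matrix.vecMulVec (D.mulVec v) (star (D.mulVec v)) := by
    rw [Matrix.mul_vecMulVec, Matrix.vecMulVec_mul, Matrix.star_mulVec]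
  simp [stein, this, Matrix.vecMulVec_apply, Finset.sum_apply]

/-- The estimate says that δ(T) strictly decreases the norm ‖Bζ‖, with a gap c‖ζ‖². As ‖Bζ‖² ≤
C‖ζ‖², the gap is at least the fraction c/C of ‖Bζ‖², so ‖δ(T')‖² ≤ 1 - c/C. -/
theorem gdel_of_similar {δ : PolyMat d J} {T T' : Tup d k} {B : Matrix (Fin k) (Fin k) ℂ}
    {B' : (Matrix (Fin k) (Fin k) ℂ)ˣ} (hB' : ↑B' = B) (hT : T ∈ gdel δ k)
    (hint : ∀ i, T' i * B = B * T i) {c : ℝ} (hc : 0 < c)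
    (h : ∀ ζ, ‖tensId (Tens J ℂ) B (deltaOp δ T ℂ ζ)‖ ^ 2 + c * ‖ζ‖ ^ 2 ≤
      ‖tensId (Tens J ℂ) B ζ‖ ^ 2) : T' ∈ gdel δ k := by
  refine ⟨hT.1, ?_⟩
  set C := ‖tensId (Tens J ℂ) B‖ ^ 2 + c with hC
  have hC0 : 0 < C := by positivity
  have hcC : c / C ≤ 1 := by
    rw [div_le_one hC0, hC]
    exact le_add_of_nonneg_left (sq_nonneg _)
  have hlt : Real.sqrt (1 - c / C) < 1 := by
    rw [Real.sqrt_lt' one_pos]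
    have : 0 < c / C := by positivity
    linarith
  refine lt_of_le_of_lt (ContinuousLinearMap.opNorm_le_bound _ (Real.sqrt_nonneg _)
    fun η => ?_) hlt
  obtain ⟨ζ, hη⟩ : ∃ ζ, η = tensId (Tens J ℂ) B ζ :=
    ⟨tensId (Tens J ℂ) (↑B'⁻¹ : Matrix (Fin k) (Fin k) ℂ) η, by
      rw [← tensId_mul, ← hB', B'.mul_inv, tensId_one]⟩
  rw [hη, deltaOp_intertwine δ hint, ← sq_le_sq₀ (norm_nonneg _) (by positivity), mul_pow,
    Real.sq_sqrt (by linarith)]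
  have h1 := h ζ
  have h2 : ‖tensId (Tens J ℂ) B ζ‖ ^ 2 ≤ C * ‖ζ‖ ^ 2 := by
    have := pow_le_pow_left₀ (norm_nonneg _) ((tensId (Tens J ℂ) B).le_opNorm ζ) 2
    rw [mul_pow] at this
    have h0 : 0 ≤ c * ‖ζ‖ ^ 2 := by positivity
    rw [hC, add_mul]
    linarith
  have h3 : c / C * ‖tensId (Tens J ℂ) B ζ‖ ^ 2 ≤ c * ‖ζ‖ ^ 2 := by
    rw [div_mul_eq_mul_div, div_le_iff₀ hC0, mul_assoc, mul_comm _ C]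
    gcongr
  rw [sub_mul, one_mul]
  linarith

open scoped ComplexOrder in
-- Otherwise a separating functional defines a new Hilbert norm on ℂ^k, in which δ(T) is still a
-- strict contraction while φ(T) increases the norm of e. Passing to the similar point T' = BTB⁻¹
-- turns this norm into the standard one and contradicts ‖φ(T')‖ ≤ 1.
theorem rankOne_mem_steinCone (hJ : 0 < J) {δ : PolyMat d J} {T : Tup d k} (hT : T ∈ gdel δ k)
    {φ : OpGraded d ℂ ℂ} (hφ : IsNC (gdel δ) φ)
    (hb : ∀ (m : ℕ) (x : Tup d m), x ∈ gdel δ m → ‖φ m x‖ ≤ 1) (e : Tens k ℂ) :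
    (fun s t => e s * star (e t) - φ k T e s * star (φ k T e t)) ∈
      steinCone (deltaMat δ T) := by
  by_contra hneg
  set r := ‖deltaOp δ T ℂ‖ with hr
  have hr0 : 0 ≤ r := norm_nonneg _
  have hr1 : r < 1 := hT.2
  obtain ⟨F, hF1, hF2⟩ := exists_separating (by nlinarith) (deltaMat_bound δ T) hneg
  obtain ⟨R, hR, hRF⟩ := exists_hermitian_form F
  let rk : (Fin k → ℂ) → (Fin k → Fin k → ℂ) := fun v s t => v s * star (v t)
  -- The separation is strict, so F may be perturbed by a small multiple of the norm squared. This
  -- makes the form Q positive definite rather than semidefinite. The ε chosen uses up at most half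
  -- of the gap.
  obtain ⟨ε, hε, hFε⟩ : ∃ ε : ℝ, 0 < ε ∧ F (rk e) + ε * ‖e‖ ^ 2 < F (rk (φ k T e)) := by
    have h1 : F (rk e) - F (rk (φ k T e)) < 0 := by rw [← map_sub]; exact hF1
    refine ⟨(F (rk (φ k T e)) - F (rk e)) / (2 * (‖e‖ ^ 2 + 1)), by
      apply div_pos <;> [linarith; positivity], ?_⟩
    have h2 : (F (rk (φ k T e)) - F (rk e)) / (2 * (‖e‖ ^ 2 + 1)) * ‖e‖ ^ 2 ≤
        (F (rk (φ k T e)) - F (rk e)) / 2 := by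
      rw [div_mul_eq_mul_div, div_le_div_iff₀ (by positivity) (by norm_num)]
      nlinarith [sq_nonneg ‖e‖]
    linarith
  let Q : Tens k ℂ → ℝ := fun v => F (rk v) + ε * ‖v‖ ^ 2
  -- the slices of a vector of `ℂ^k ⊗ ℂ^J`
  let sl : Tens k (Tens J ℂ) → Fin J → Tens k ℂ := fun η a => WithLp.toLp 2 fun s => η s a
  have hsl : ∀ η, ∑ a, ‖sl η a‖ ^ 2 = ‖η‖ ^ 2 := by
    intro η
    simp only [tens_norm_sq]
    exact Finset.sum_comm
  let q : Tens k (Tens J ℂ) → ℝ := fun η => ∑ a, Q (sl η a)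
  -- F is nonnegative on the Stein difference of the rank one matrix ηη*, and the ε-term contributes
  -- ε(‖η‖² - ‖δ(T)η‖²) ≥ ε(1 - r²)‖η‖².
  have hstep : ∀ η, q (deltaOp δ T ℂ η) + ε * (1 - r ^ 2) * ‖η‖ ^ 2 ≤ q η := by
    intro η
    have hη : toTens (fun i => η i.1 i.2) = η := rfl
    have h1 := hF2 _ (Matrix.posSemidef_vecMulVec_self_star (fun i : Fin k × Fin J => η i.1 i.2))
    rw [stein_rankOne, map_sub, map_sum, map_sum] at h1
    have h2 : ∀ a, F (rk (sl (deltaOp δ T ℂ η) a)) = F (fun s t =>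
        (deltaMat δ T).mulVec (fun i => η i.1 i.2) (s, a) *
          star ((deltaMat δ T).mulVec (fun i => η i.1 i.2) (t, a))) := by
      intro a
      conv_lhs => rw [← hη, deltaOp_toTens]
      rfl
    have h3 : ‖deltaOp δ T ℂ η‖ ^ 2 ≤ r ^ 2 * ‖η‖ ^ 2 := by
      rw [← mul_pow]; gcongr; exact ContinuousLinearMap.le_opNorm _ _
    simp only [q, Q, Finset.sum_add_distrib, ← Finset.mul_sum, hsl, h2]
    have h4 : ∑ a, F (rk (sl η a)) = ∑ a, F (fun s t => η s a * star (η t a)) := rfl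
    rw [h4]
    nlinarith
  have hqlow : ∀ η, -((‖F‖) * ‖η‖ ^ 2) ≤ q η := by
    intro η
    have h1 : ∀ v : Tens k ℂ, -(‖F‖ * ‖v‖ ^ 2) ≤ Q v := by
      intro v
      have h2 : ‖rk v‖ ≤ ‖v‖ ^ 2 := by
        refine (pi_norm_le_iff_of_nonneg (by positivity)).2 fun s =>
          (pi_norm_le_iff_of_nonneg (by positivity)).2 fun t => ?_
        rw [norm_mul, norm_star, sq]
        exact mul_le_mul (PiLp.norm_apply_le v s) (PiLp.norm_apply_le v t) (norm_nonneg _)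
          (norm_nonneg _)
      have h3 := (abs_le.1 (F.le_opNorm (rk v))).1
      have h4 : ‖F‖ * ‖rk v‖ ≤ ‖F‖ * ‖v‖ ^ 2 := by gcongr
      have : 0 ≤ ε * ‖v‖ ^ 2 := by positivity
      simp only [Q]
      linarith
    rw [← hsl η, Finset.mul_sum, ← Finset.sum_neg_distrib]
    exact Finset.sum_le_sum fun a _ => h1 _
  have hc : 0 < ε * (1 - r ^ 2) := mul_pos hε (by nlinarith)
  have hqpos : ∀ η, ε * (1 - r ^ 2) * ‖η‖ ^ 2 ≤ q η :=
    le_of_stein hr0 hr1 (norm_nonneg F) hc.le (fun v => ContinuousLinearMap.le_opNorm _ _)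
      hqlow hstep
  have hQpos : ∀ v : Tens k ℂ, ε * (1 - r ^ 2) * ‖v‖ ^ 2 ≤ Q v := by
    intro v
    -- Positivity of q passes to Q by placing v in a single slot of ℂ^J.
    let a₀ : Fin J := ⟨0, hJ⟩
    let η : Tens k (Tens J ℂ) := WithLp.toLp 2 fun s => WithLp.toLp 2 (Pi.single a₀ (v s))
    have h0 : sl η a₀ = v := by ext s; simp [sl, η]
    have h1 : ∀ a, a ≠ a₀ → sl η a = 0 := by intro a ha; ext s; simp [sl, η, ha]
    have hQ0 : Q 0 = 0 := by
      have : rk ((0 : Tens k ℂ)) = 0 := by funext s t; simp [rk]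
      simp only [Q, this, map_zero, norm_zero]
      ring
    have h2 : q η = Q v := by
      simp only [q]
      rw [Finset.sum_eq_single a₀ (fun a _ ha => by rw [h1 a ha, hQ0]) (by simp), h0]
    have h3 : ‖η‖ ^ 2 = ‖v‖ ^ 2 := by
      rw [← hsl, Finset.sum_eq_single a₀ (fun a _ ha => by rw [h1 a ha]; simp) (by simp), h0]
    rw [← h2, ← h3]
    exact hqpos η
  -- the form `Q` is given by an invertible matrix
  have hRQ : ∀ v : Fin k → ℂ, dotProduct (star v) ((R + (ε : ℂ) • 1).mulVec v) =
      (Q (WithLp.toLp 2 v) : ℂ) := by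
    intro v
    rw [Matrix.add_mulVec, dotProduct_add, hRF, Matrix.smul_mulVec, dotProduct_smul,
      Matrix.one_mulVec]
    have : dotProduct (star v) v = ((‖(WithLp.toLp 2 v : Tens k ℂ)‖ ^ 2 : ℝ) : ℂ) := by
      rw [tens_norm_sq]
      simp [dotProduct, Complex.conj_mul']
    rw [this]
    simp [Q, rk]
  have hpsd : (R + (ε : ℂ) • 1).PosSemidef := by
    refine Matrix.PosSemidef.of_dotProduct_mulVec_nonneg ?_ fun v => ?_
    · refine hR.add ?_
      ext s t
      by_cases h : s = t <;> simp [h, eq_comm]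
    · rw [hRQ]
      exact_mod_cast le_trans (by positivity) (hQpos _)
  obtain ⟨M, hM⟩ := exists_factor hpsd
  set B := M.conjTranspose with hB
  have hBQ : ∀ v : Tens k ℂ, ‖tensId ℂ B v‖ ^ 2 = Q v := by
    intro v
    have h1 := hRQ v
    rw [← hM, ← Matrix.mulVec_mulVec, Matrix.dotProduct_mulVec] at h1
    have h2 : Matrix.vecMul (star (v : Fin k → ℂ)) M = star (B.mulVec v) := by
      rw [Matrix.star_mulVec, hB, Matrix.conjTranspose_conjTranspose]
    rw [h2] at h1
    have h3 : ((‖tensId ℂ B v‖ ^ 2 : ℝ) : ℂ) = dotProduct (star (B.mulVec v)) (B.mulVec v) := by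
      rw [tens_norm_sq]
      simp only [dotProduct, tensId_apply, Matrix.mulVec, Pi.star_apply, Complex.star_def,
        Complex.conj_mul', smul_eq_mul]
      push_cast
      rfl
    rw [← h3] at h1
    exact_mod_cast h1
  have hBunit : IsUnit B := by
    rw [← Matrix.mulVec_injective_iff_isUnit]
    refine (injective_iff_map_eq_zero (Matrix.mulVecLin B)).2 fun v hv => ?_
    have h1 : tensId ℂ B (WithLp.toLp 2 v) = 0 := by
      ext s
      simpa [tensId_apply, Matrix.mulVec, dotProduct] using congrFun hv s
    have h2 := hBQ (WithLp.toLp 2 v)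
    rw [h1, norm_zero] at h2
    have h3 := hQpos (WithLp.toLp 2 v)
    rw [← h2] at h3
    have h4 : ‖(WithLp.toLp 2 v : Tens k ℂ)‖ ^ 2 ≤ 0 := by
      by_contra! h
      nlinarith
    have h5 : (WithLp.toLp 2 v : Tens k ℂ) = 0 := by
      rw [← norm_eq_zero]; nlinarith [norm_nonneg (WithLp.toLp 2 v : Tens k ℂ)]
    exact congrArg WithLp.ofLp h5
  obtain ⟨B', hB'⟩ := hBunit
  let T' : Tup d k := fun i => B * T i * (↑B'⁻¹ : Matrix (Fin k) (Fin k) ℂ)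
  have hint : ∀ i, T' i * B = B * T i := by
    intro i
    simp only [T']
    rw [Matrix.mul_assoc, ← hB', B'.inv_mul, Matrix.mul_one]
  have hBq : ∀ η : Tens k (Tens J ℂ), ‖tensId (Tens J ℂ) B η‖ ^ 2 = q η := by
    intro η
    rw [← hsl]
    refine Finset.sum_congr rfl fun a _ => ?_
    rw [← hBQ]
    congr 2
    ext s
    simp [sl, tensId_apply]
  have hT' : T' ∈ gdel δ k := by
    refine gdel_of_similar hB' hT hint hc fun ζ => ?_
    rw [hBq, hBq]
    exact hstep ζ
  -- Now φ(T')Be = Bφ(T)e, so contractivity reads Q(φ(T)e) ≤ Q(e), contrary to the choice of ε.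
  have h1 := hφ.intertwine hT' hT hint e
  have h2 : ‖φ k T' (tensId ℂ B e)‖ ≤ ‖tensId ℂ B e‖ :=
    ((φ k T').le_of_opNorm_le (hb _ _ hT') _).trans (by rw [one_mul])
  rw [h1] at h2
  have h3 := pow_le_pow_left₀ (norm_nonneg _) h2 2
  rw [hBQ, hBQ] at h3
  simp only [Q] at h3
  have : 0 ≤ ε * ‖φ k T e‖ ^ 2 := by positivity
  linarith

/-- **Cyclic model**: a contractive nc-function has a finite-dimensional model on the cyclic
space generated by a vector. -/
theorem exists_cyclic_model (hJ : 0 < J) {δ : PolyMat d J} {T : Tup d k} (hT : T ∈ gdel δ k)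
    {φ : OpGraded d ℂ ℂ} (hφ : IsNC (gdel δ) φ)
    (hb : ∀ (m : ℕ) (x : Tup d m), x ∈ gdel δ m → ‖φ m x‖ ≤ 1) (e : Tens k ℂ) :
    ∃ u : Tens k (Aux J (k * J)), ∀ s t,
      inner ℂ (e s) (e t) + inner ℂ (deltaOp δ T _ u s) (deltaOp δ T _ u t) =
        inner ℂ (φ k T e s) (φ k T e t) + inner ℂ (u s) (u t) := by
  obtain ⟨K, hK, hKe⟩ := rankOne_mem_steinCone hJ hT hφ hb e
  obtain ⟨M, rfl⟩ := exists_factor hK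
  -- With K = MM*, the rows of M are the coefficients of u, so L has one coordinate for each of the
  -- k * J columns.
  refine ⟨WithLp.toLp 2 fun s => WithLp.toLp 2 fun a => WithLp.toLp 2 fun c =>
    M (s, a) (finProdFinEquiv.symm c), fun s t => ?_⟩
  -- The indices are swapped because the inner product is conjugate-linear in its first argument.
  have h1 := congrFun (congrFun hKe t) s
  have h2 : deltaMat δ T * (M * M.conjTranspose) * (deltaMat δ T).conjTranspose =
      (deltaMat δ T * M) * (deltaMat δ T * M).conjTranspose := by
    rw [Matrix.conjTranspose_mul]; simp only [Matrix.mul_assoc]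
  simp only [stein, LinearMap.coe_mk, AddHom.coe_mk, h2, Matrix.sub_apply,
    Finset.sum_sub_distrib] at h1
  have h3 : ∀ N : Matrix (Fin k × Fin J) (Fin k × Fin J) ℂ, ∀ s t a,
      (N * N.conjTranspose) (t, a) (s, a) = inner ℂ
        (WithLp.toLp 2 fun c => N (s, a) (finProdFinEquiv.symm c) :
          EuclideanSpace ℂ (Fin (k * J)))
        (WithLp.toLp 2 fun c => N (t, a) (finProdFinEquiv.symm c)) := by
    intro N s t a
    simp only [PiLp.inner_apply, Matrix.mul_apply, Matrix.conjTranspose_apply]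
    rw [← Equiv.sum_comp finProdFinEquiv]
    simp
  simp only [h3] at h1
  have h4 : ∀ s, (deltaOp δ T (EuclideanSpace ℂ (Fin (k * J))) (WithLp.toLp 2 fun s =>
      WithLp.toLp 2 fun a => WithLp.toLp 2 fun c => M (s, a) (finProdFinEquiv.symm c))) s =
      WithLp.toLp 2 fun a => WithLp.toLp 2 fun c =>
        (deltaMat δ T * M) (s, a) (finProdFinEquiv.symm c) := by
    intro s
    ext a c
    rw [deltaOp_apply]
    simp [deltaMat, Matrix.mul_apply, Fintype.sum_prod_type, WithLp.ofLp_sum]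
  rw [h4, h4, tens_inner, tens_inner]
  simp only [RCLike.inner_apply, ← Complex.star_def]
  linear_combination -h1

end Cyclic

/-! ### A common cyclic point over finitely many points -/

section Common

variable {d J : ℕ}

/-- The entries of the values of a free polynomial at finitely many points. -/
def evalAll (F : Finset (Σ m, Tup d m)) :
    Poly d →ₗ[ℂ] EuclideanSpace ℂ (Σ X : F, Fin X.1.1 × Fin X.1.1) where
  toFun p := WithLp.toLp 2 fun z => polyEval p z.1.1.2 z.2.1 z.2.2
  map_add' p q := by ext z; simp [polyEval]
  map_smul' c p := by ext z; simp [polyEval]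

/-- T is left multiplication by the variables on the space of restrictions of polynomials to F, in
an orthonormal basis represented by the polynomials `P s`, and e is the constant 1. Taking columns
of values embeds this space isometrically into a direct sum of copies of the spaces of the points X
in F, intertwining T with the X. Hence ‖δ(T)‖ is at most the largest ‖δ(X)‖, which is below 1 since
F is finite. -/
theorem exists_common_point {δ : PolyMat d J} {F : Finset (Σ m, Tup d m)} (hne : F.Nonempty)
    (hF : ∀ X ∈ F, X.2 ∈ gdel δ X.1) :
    ∃ (k : ℕ) (T : Tup d k) (P : Fin k → Poly d) (e : Tens k ℂ), T ∈ gdel δ k ∧ ∀ X ∈ F,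
      (∑ s, e s • polyEval (P s) X.2 = 1) ∧
      ∀ r t, X.2 r * polyEval (P t) X.2 = ∑ s, T r s t • polyEval (P s) X.2 := by
  classical
  let k := Module.finrank ℂ (LinearMap.range (evalAll F))
  let b : OrthonormalBasis (Fin k) ℂ (LinearMap.range (evalAll F)) :=
    stdOrthonormalBasis ℂ (LinearMap.range (evalAll F))
  choose P hP using fun s => (b s).2
  let c : Poly d → Fin k → ℂ := fun p s => b.repr ⟨evalAll F p, LinearMap.mem_range_self _ p⟩ s
  have hc : ∀ p, ∀ X ∈ F, polyEval p X.2 = ∑ s, c p s • polyEval (P s) X.2 := by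
    intro p X hX
    have h1 := congrArg Subtype.val
      (b.sum_repr ⟨evalAll F p, LinearMap.mem_range_self _ p⟩)
    rw [AddSubmonoidClass.coe_finsetSum] at h1
    ext i j
    have h2 := congrArg (fun z : EuclideanSpace ℂ (Σ X : F, Fin X.1.1 × Fin X.1.1) =>
      z ⟨⟨X, hX⟩, i, j⟩) h1
    simp only [Submodule.coe_smul, ← hP, WithLp.ofLp_sum, WithLp.ofLp_smul, Finset.sum_apply,
      Pi.smul_apply] at h2
    rw [Matrix.sum_apply]
    exact h2.symm
  let T : Tup d k := fun r => Matrix.of fun s t => c (FreeAlgebra.ι ℂ r * P t) s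
  let e : Tens k ℂ := WithLp.toLp 2 fun s => c 1 s
  have he : ∀ X ∈ F, ∑ s, e s • polyEval (P s) X.2 = 1 := by
    intro X hX
    rw [← hc 1 X hX]
    simp [polyEval]
  have hT : ∀ X ∈ F, ∀ r t, X.2 r * polyEval (P t) X.2 = ∑ s, T r s t • polyEval (P s) X.2 := by
    intro X hX r t
    have := hc (FreeAlgebra.ι ℂ r * P t) X hX
    simp only [T, Matrix.of_apply]
    rw [← this]
    simp [polyEval]
  -- `B X j` sends coordinates to the j-th column of the value at X. By `hnorm` these maps together
  -- form an isometry.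
  let B : (X : F) → Fin X.1.1 → Matrix (Fin X.1.1) (Fin k) ℂ :=
    fun X j => Matrix.of fun i s => polyEval (P s) X.1.2 i j
  have hB : ∀ X j r, X.1.2 r * B X j = B X j * T r := by
    intro X j r
    ext i t
    have := congrFun (congrFun (hT X.1 X.2 r t) i) j
    simpa [Matrix.mul_apply, B, Matrix.sum_apply, mul_comm] using this
  have hnorm : ∀ v : Tens k (Tens J ℂ),
      ∑ X, ∑ j, ‖tensId (Tens J ℂ) (B X j) v‖ ^ 2 = ‖v‖ ^ 2 := by
    intro v
    have h1 : ∀ a, ∑ s, ‖v s a‖ ^ 2 = ∑ X, ∑ j, ∑ i, ‖tensId (Tens J ℂ) (B X j) v i a‖ ^ 2 := by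
      intro a
      have h2 : ‖b.repr.symm (WithLp.toLp 2 fun s => v s a)‖ ^ 2 = ∑ s, ‖v s a‖ ^ 2 := by
        rw [LinearIsometryEquiv.norm_map, EuclideanSpace.norm_sq_eq]
      rw [← h2, ← b.sum_repr_symm, Submodule.coe_norm, AddSubmonoidClass.coe_finsetSum,
        EuclideanSpace.norm_sq_eq, Fintype.sum_sigma]
      refine Finset.sum_congr rfl fun X _ => ?_
      rw [Fintype.sum_prod_type, Finset.sum_comm]
      refine Finset.sum_congr rfl fun j _ => Finset.sum_congr rfl fun i _ => ?_
      simp only [Submodule.coe_smul, ← hP, WithLp.ofLp_sum, WithLp.ofLp_smul, Finset.sum_apply,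
        Pi.smul_apply, tensId_apply, smul_eq_mul]
      congr 2
      exact Finset.sum_congr rfl fun s _ => mul_comm _ _
    have h3 : ‖v‖ ^ 2 = ∑ a, ∑ s, ‖v s a‖ ^ 2 := by
      simp only [tens_norm_sq]
      exact Finset.sum_comm
    rw [h3, Finset.sum_congr rfl fun a _ => h1 a, Finset.sum_comm]
    refine Finset.sum_congr rfl fun X _ => ?_
    rw [Finset.sum_comm]
    refine Finset.sum_congr rfl fun j _ => ?_
    simp only [tens_norm_sq]
    exact Finset.sum_comm
  obtain ⟨X₀, hX₀, hmax⟩ := F.exists_max_image (fun X => ‖deltaOp δ X.2 ℂ‖) hne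
  refine ⟨k, T, P, e, ⟨?_, ?_⟩, fun X hX => ⟨he X hX, hT X hX⟩⟩
  -- Were the space zero, the constant 1 would vanish at a point of positive size.
  · by_contra hk
    have : IsEmpty (Fin k) := by
      rw [Nat.pos_iff_ne_zero, not_not] at hk
      rw [hk]; infer_instance
    have h1 := he X₀ hX₀
    rw [Finset.univ_eq_empty, Finset.sum_empty] at h1
    have h2 := congrFun (congrFun h1 ⟨0, (hF X₀ hX₀).1⟩) ⟨0, (hF X₀ hX₀).1⟩
    simp at h2
  · refine lt_of_le_of_lt (ContinuousLinearMap.opNorm_le_bound _ (norm_nonneg _)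
      fun v => ?_) (hF X₀ hX₀).2
    rw [← sq_le_sq₀ (norm_nonneg _) (by positivity), mul_pow, ← hnorm, ← hnorm v,
      Finset.mul_sum]
    refine Finset.sum_le_sum fun X _ => ?_
    rw [Finset.mul_sum]
    refine Finset.sum_le_sum fun j _ => ?_
    rw [← deltaOp_intertwine δ (hB X j), ← mul_pow]
    gcongr
    exact (deltaOp δ X.1.2 ℂ).le_of_opNorm_le (hmax X.1 X.2) _

end Common

/-! ### Isometries from Gram matrices -/

section Gram

variable {E : Type} [NormedAddCommGroup E] [InnerProductSpace ℂ E] [FiniteDimensional ℂ E]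

/-- Two families of vectors with the same Gram matrix are related by an isometry. -/
theorem exists_isometry_of_gram {ι : Type} {p q : ι → E}
    (h : ∀ i j, inner ℂ (p i) (p j) = inner ℂ (q i) (q j)) :
    ∃ W : E →ₗᵢ[ℂ] E, ∀ i, W (p i) = q i := by
  let A := Finsupp.linearCombination ℂ p
  let B := Finsupp.linearCombination ℂ q
  have hn : ∀ c, ‖B c‖ = ‖A c‖ := by
    intro c
    have : inner ℂ (B c) (B c) = inner ℂ (A c) (A c) := by
      simp only [A, B, Finsupp.linearCombination_apply, Finsupp.sum, sum_inner, inner_sum,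
        inner_smul_left, inner_smul_right, h]
    rw [inner_self_eq_norm_sq_to_K, inner_self_eq_norm_sq_to_K] at this
    have h2 : ‖B c‖ ^ 2 = ‖A c‖ ^ 2 := by exact_mod_cast this
    exact (sq_eq_sq₀ (norm_nonneg _) (norm_nonneg _)).1 h2
  -- As ‖Bc‖ = ‖Ac‖, the map B factors through the range of A. Composing with any linear section g
  -- gives the isometry, which then extends to E by finite-dimensionality.
  obtain ⟨g, hg⟩ := A.rangeRestrict.exists_rightInverse_of_surjective A.range_rangeRestrict
  have hg' : ∀ s, A (g s) = s := fun s => congrArg Subtype.val (LinearMap.congr_fun hg s)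
  let L : LinearMap.range A →ₗᵢ[ℂ] E :=
    ⟨B ∘ₗ g, fun s => by
      rw [LinearMap.comp_apply, hn, hg', Submodule.coe_norm]⟩
  refine ⟨L.extend, fun i => ?_⟩
  have hp : A (Finsupp.single i 1) = p i := by simp [A]
  have hq : B (Finsupp.single i 1) = q i := by simp [B]
  have h1 := L.extend_apply ⟨A (Finsupp.single i 1), LinearMap.mem_range_self _ _⟩
  rw [← hp, ← hq]
  refine h1.trans (sub_eq_zero.1 ?_)
  change B (g _) - B _ = 0
  rw [← map_sub, ← norm_eq_zero, hn, map_sub, hg', sub_self, norm_zero]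

/-- A space splits isometrically so that finitely many given vectors come to lie in a space of
prescribed dimension. -/
theorem exists_splitting {κ : Type} [Fintype κ] (y : κ → E) :
    ∃ (g₀ : E →L[ℂ] EuclideanSpace ℂ (Fin (Fintype.card κ))) (g₁ : E →L[ℂ] E),
      (∀ h h', inner ℂ (g₀ h) (g₀ h') + inner ℂ (g₁ h) (g₁ h') = inner ℂ h h') ∧
      ∀ i, g₁ (y i) = 0 := by
  let S := Submodule.span ℂ (Set.range y)
  have hle : Module.finrank ℂ S ≤ Fintype.card κ := finrank_range_le_card y
  let b := stdOrthonormalBasis ℂ S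
  let v := EuclideanSpace.basisFun (Fin (Fintype.card κ)) ℂ
  let j₀ : S →ₗ[ℂ] EuclideanSpace ℂ (Fin (Fintype.card κ)) :=
    b.toBasis.constr ℂ fun i => v (Fin.castLE hle i)
  have hb : Orthonormal ℂ b.toBasis := by rw [b.coe_toBasis]; exact b.orthonormal
  have hj : Orthonormal ℂ (j₀ ∘ b.toBasis) := by
    have : j₀ ∘ b.toBasis = v ∘ Fin.castLE hle := by
      funext i; exact b.toBasis.constr_basis ℂ _ i
    rw [this]
    exact v.orthonormal.comp _ (Fin.castLE_injective hle)
  let j := j₀.isometryOfOrthonormal hb hj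
  refine ⟨j.toContinuousLinearMap ∘L S.orthogonalProjectionOnto,
    ContinuousLinearMap.id ℂ E - S.starProjection, fun h h' => ?_, fun i => ?_⟩
  · have e1 : inner ℂ (j (S.orthogonalProjectionOnto h)) (j (S.orthogonalProjectionOnto h')) =
        inner ℂ (S.starProjection h) (S.starProjection h') := by
      rw [j.inner_map_map]; rfl
    have e2 := S.inner_starProjection_left_eq_right h h'
    have e3 := S.inner_starProjection_left_eq_right h (S.starProjection h')
    have e4 : S.starProjection (S.starProjection h') = S.starProjection h' :=
      Submodule.starProjection_eq_self_iff.2 (Submodule.starProjection_apply_mem _ _)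
    rw [e4] at e3
    simp only [ContinuousLinearMap.comp_apply, sub_apply,
      ContinuousLinearMap.id_apply, inner_sub_left, inner_sub_right,
      LinearIsometry.coe_toContinuousLinearMap]
    rw [e1, e2, e3]
    ring
  · have : S.starProjection (y i) = y i :=
      Submodule.starProjection_eq_self_iff.2 (Submodule.subset_span ⟨i, rfl⟩)
    simp [this]

end Gram

/-! ### Vectors of ℂ^m ⊗ (E ⊕ F) -/

section Pair

variable {E F : Type} [NormedAddCommGroup E] [InnerProductSpace ℂ E]
  [NormedAddCommGroup F] [InnerProductSpace ℂ F] {m k : ℕ}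

/-- The vector of `ℂ^m ⊗ (E ⊕ F)` with components `a` and `b`. -/
def pairT (a : Tens m E) (b : Tens m F) : Tens m (HSum E F) :=
  WithLp.toLp 2 fun i => WithLp.toLp 2 (a i, b i)

@[simp] theorem pairT_apply (a : Tens m E) (b : Tens m F) (i : Fin m) :
    pairT a b i = WithLp.toLp 2 (a i, b i) := rfl

theorem tensId_pairT (B : Matrix (Fin m) (Fin k) ℂ) (a : Tens k E) (b : Tens k F) :
    tensId (HSum E F) B (pairT a b) = pairT (tensId E B a) (tensId F B b) := by
  ext1 i
  refine hsum_ext ?_ ?_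
  · rw [← WithLp.fstL_apply (𝕜 := ℂ) 2, tensId_apply, map_sum]
    simp [tensId_apply]
  · rw [← WithLp.sndL_apply (𝕜 := ℂ) 2, tensId_apply, map_sum]
    simp [tensId_apply]

theorem norm_sq_pairT (a : Tens m E) (b : Tens m F) :
    ‖pairT a b‖ ^ 2 = ‖a‖ ^ 2 + ‖b‖ ^ 2 := by
  simp only [tens_norm_sq, pairT_apply, hsum_norm_sq, Finset.sum_add_distrib]
  rfl

theorem pair_inner (a c : E) (b d : F) :
    inner ℂ (WithLp.toLp 2 (a, b) : HSum E F) (WithLp.toLp 2 (c, d)) =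
      inner ℂ a c + inner ℂ b d :=
  WithLp.prod_inner_apply _ _

theorem inner_pair_zero (a c : E) :
    inner ℂ (WithLp.toLp 2 (a, 0) : HSum E F) (WithLp.toLp 2 (c, 0)) = inner ℂ a c := by
  rw [pair_inner, inner_zero_left, add_zero]

/-- The elementary tensor `c ⊗ e`. -/
def elemT (c : Fin m → ℂ) (e : E) : Tens m E := WithLp.toLp 2 fun i => c i • e

@[simp] theorem elemT_apply (c : Fin m → ℂ) (e : E) (i : Fin m) : elemT c e i = c i • e := rfl

theorem deltaOp_ampl {d J : ℕ} (δ : PolyMat d J) (x : Tup d m) (g : E →L[ℂ] F)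
    (v : Tens m (Tens J E)) :
    deltaOp δ x F (ampl m (ampl J g) v) = ampl m (ampl J g) (deltaOp δ x E v) := by
  ext i a
  simp [deltaOp_apply, ampl_apply, map_sum]

theorem vecEval_apply {d J l : ℕ} (u : VecPoly d J l) (x : Tup d m) (v : Tens m ℂ) (i : Fin m)
    (a : Fin J) (b : Fin l) :
    vecEval u x v i a b = ∑ j, v j * polyEval (u a b) x i j := by
  simp [vecEval, ofVec, vecCoeff, WithLp.ofLp_sum, ContinuousLinearMap.toSpanSingleton_apply]

end Pair

/-! ### Partial realizations over finitely many points -/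

section FiniteStage

variable {d J n : ℕ}

/-- The dimension bound for the space spanned by the coefficients of a model at a tuple of
`n × n` matrices. -/
abbrev auxDim (n J : ℕ) : ℕ := Fintype.card (Fin n × Fin n × Fin J)

/-- Ξ is the transfer function of an isometric colligation from which only the state u₁ has been
eliminated; u₀ stays among the inputs and outputs, so the coefficient space of Ξ does not depend on
F. Since u₁ vanishes at Λ, the colligation maps the Λ-vectors without using the state, which forces
Ξ to act on them as a constant operator at every x. -/
theorem exists_partial_realization (hJ : 0 < J) {δ : PolyMat d J} {φ : OpGraded d ℂ ℂ}
    (hφ : IsNC (gdel δ) φ) (hb : ∀ (m : ℕ) (x : Tup d m), x ∈ gdel δ m → ‖φ m x‖ ≤ 1)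
    {Λ : Tup d n} (hΛ : Λ ∈ gdel δ n) (F : Finset (Σ m, Tup d m))
    (hF : ∀ X ∈ F, X.2 ∈ gdel δ X.1) :
    ∃ (Ξ : OpGraded d (HSum ℂ (Aux J (auxDim n J))) (HSum ℂ (Aux J (auxDim n J))))
      (u : VecPoly d J (auxDim n J)),
      IsNC (gdel δ) Ξ ∧ (∀ (m : ℕ) (x : Tup d m), x ∈ gdel δ m → ‖Ξ m x‖ ≤ 1) ∧
      (∀ X ∈ F, ∀ v, Ξ X.1 X.2 (pairT v (deltaOp δ X.2 _ (vecEval u X.2 v))) =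
        pairT (φ X.1 X.2 v) (vecEval u X.2 v)) ∧
      (∀ i j v w, inner ℂ (pairT v (deltaOp δ Λ _ (vecEval u Λ v)) i)
          (pairT w (deltaOp δ Λ _ (vecEval u Λ w)) j) =
        inner ℂ (pairT (φ n Λ v) (vecEval u Λ v) i) (pairT (φ n Λ w) (vecEval u Λ w) j)) ∧
      ∀ (m : ℕ) (x : Tup d m), x ∈ gdel δ m → ∀ (c : Fin m → ℂ) i v,
        Ξ m x (elemT c (pairT v (deltaOp δ Λ _ (vecEval u Λ v)) i)) =
          elemT c (pairT (φ n Λ v) (vecEval u Λ v) i) := by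
  classical
  obtain ⟨k, T, P, e, hT, hP⟩ := exists_common_point (F := insert ⟨n, Λ⟩ F)
    (Finset.insert_nonempty _ _) (δ := δ) (by
      intro X hX
      rcases Finset.mem_insert.1 hX with rfl | hX
      · exact hΛ
      · exact hF X hX)
  obtain ⟨u, hu⟩ := exists_cyclic_model hJ hT hφ hb e
  -- a matrix intertwining `x` and `T` that sends `e` to `v`
  let B : ∀ {m : ℕ}, Tup d m → Tens m ℂ → Matrix (Fin m) (Fin k) ℂ := fun x v =>
    Matrix.of fun i s => ∑ j, v j * polyEval (P s) x i j
  have hBint : ∀ X ∈ insert ⟨n, Λ⟩ F, ∀ v r, X.2 r * B X.2 v = B X.2 v * T r := by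
    intro X hX v r
    ext i t
    have h1 : ∀ j, ∑ a, X.2 r i a * polyEval (P t) X.2 a j =
        ∑ s, T r s t * polyEval (P s) X.2 i j := by
      intro j
      have := congrFun (congrFun ((hP X hX).2 r t) i) j
      simpa [Matrix.mul_apply, Matrix.sum_apply] using this
    simp only [Matrix.mul_apply, B, Matrix.of_apply, Finset.mul_sum, Finset.sum_mul]
    rw [Finset.sum_comm, Finset.sum_comm (f := fun s j => v j * polyEval (P s) X.2 i j * T r s t)]
    refine Finset.sum_congr rfl fun j _ => ?_
    have h2 := congrArg (v j * ·) (h1 j)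
    simp only [Finset.mul_sum] at h2
    refine Eq.trans (Finset.sum_congr rfl fun a _ => ?_) (h2.trans
      (Finset.sum_congr rfl fun s _ => ?_)) <;> ring
  have hBe : ∀ X ∈ insert ⟨n, Λ⟩ F, ∀ v, tensId ℂ (B X.2 v) e = v := by
    intro X hX v
    ext i
    have h1 : ∀ j, ∑ s, e s * polyEval (P s) X.2 i j = if i = j then 1 else 0 := by
      intro j
      have := congrFun (congrFun (hP X hX).1 i) j
      simpa [Matrix.sum_apply, Matrix.one_apply] using this
    simp only [tensId_apply, B, Matrix.of_apply, smul_eq_mul, Finset.sum_mul]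
    rw [Finset.sum_comm]
    calc ∑ j, ∑ s, v j * polyEval (P s) X.2 i j * e s
        = ∑ j, v j * ∑ s, e s * polyEval (P s) X.2 i j := by
          refine Finset.sum_congr rfl fun j _ => ?_
          rw [Finset.mul_sum]
          exact Finset.sum_congr rfl fun s _ => by ring
      _ = v i := by simp [h1]
  have hmem : ∀ X ∈ insert ⟨n, Λ⟩ F, X.2 ∈ gdel δ X.1 := by
    intro X hX
    rcases Finset.mem_insert.1 hX with rfl | hX
    · exact hΛ
    · exact hF X hX
  have hBφ : ∀ X ∈ insert ⟨n, Λ⟩ F, ∀ v, tensId ℂ (B X.2 v) (φ k T e) = φ X.1 X.2 v := by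
    intro X hX v
    rw [← hφ.intertwine (hmem X hX) hT (hBint X hX v), hBe X hX]
  -- split off the coefficients at `Λ`
  let y : Fin n × Fin n × Fin J → EuclideanSpace ℂ (Fin (k * J)) := fun z =>
    ∑ s, polyEval (P s) Λ z.1 z.2.1 • u s z.2.2
  obtain ⟨g₀, g₁, hg, hgy⟩ := exists_splitting y
  let u₀ : Tens k (Aux J (auxDim n J)) := ampl k (ampl J g₀) u
  let u₁ : Tens k (Aux J (k * J)) := ampl k (ampl J g₁) u
  have hgin : ∀ a b : Aux J (k * J), inner ℂ (ampl J g₀ a) (ampl J g₀ b) +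
      inner ℂ (ampl J g₁ a) (ampl J g₁ b) = inner ℂ a b := by
    intro a b
    rw [tens_inner (ampl J g₀ a), tens_inner (ampl J g₁ a), tens_inner a, ← Finset.sum_add_distrib]
    refine Finset.sum_congr rfl fun i _ => ?_
    rw [ampl_apply, ampl_apply, ampl_apply, ampl_apply, hg]
  -- The cyclic model, with u split into u₀ and u₁, says that p and q have the same Gram matrix.
  let p : Fin k → HSum (HSum ℂ (Aux J (auxDim n J))) (Aux J (k * J)) := fun s =>
    WithLp.toLp 2 (pairT e (deltaOp δ T _ u₀) s, deltaOp δ T _ u₁ s)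
  let q : Fin k → HSum (HSum ℂ (Aux J (auxDim n J))) (Aux J (k * J)) := fun s =>
    WithLp.toLp 2 (pairT (φ k T e) u₀ s, u₁ s)
  have hgram : ∀ s t, inner ℂ (p s) (p t) = inner ℂ (q s) (q t) := by
    intro s t
    simp only [p, q, pair_inner, pairT_apply, u₀, u₁, deltaOp_ampl]
    rw [ampl_apply, ampl_apply, ampl_apply, ampl_apply, ampl_apply, ampl_apply, ampl_apply,
      ampl_apply, add_assoc, hgin, add_assoc, hgin]
    exact hu s t
  obtain ⟨W, hW⟩ := exists_isometry_of_gram hgram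
  let U := W.toContinuousLinearMap
  have hU : ∀ z, ‖U z‖ ≤ ‖z‖ := fun z => (W.norm_map z).le
  have hsysT : SystemEq δ U T (pairT e (deltaOp δ T _ u₀)) u₁ (pairT (φ k T e) u₀) := hW
  -- The polynomial whose value at x on v is the image of u₀ under the intertwiner `B x v`, so the
  -- transported u₀ depends polynomially on the point.
  let u' : VecPoly d J (auxDim n J) := fun a b => ∑ s, u₀ s a b • P s
  have hBu : ∀ {m : ℕ} (x : Tup d m) v, tensId _ (B x v) u₀ = vecEval u' x v := by
    intro m x v
    ext i a b
    rw [vecEval_apply, tensId_apply]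
    have : ∀ j, polyEval (u' a b) x i j = ∑ s, u₀ s a b * polyEval (P s) x i j := by
      intro j
      simp [u', polyEval, Matrix.sum_apply]
    simp only [this, WithLp.ofLp_sum, WithLp.ofLp_smul, Finset.sum_apply, Pi.smul_apply,
      smul_eq_mul, B, Matrix.of_apply, Finset.sum_mul, Finset.mul_sum]
    rw [Finset.sum_comm]
    exact Finset.sum_congr rfl fun j _ => Finset.sum_congr rfl fun s _ => by ring
  have hsys : ∀ X ∈ insert ⟨n, Λ⟩ F, ∀ v, SystemEq δ U X.2
      (pairT v (deltaOp δ X.2 _ (vecEval u' X.2 v))) (tensId _ (B X.2 v) u₁)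
      (pairT (φ X.1 X.2 v) (vecEval u' X.2 v)) := by
    intro X hX v
    have := hsysT.intertwine (hBint X hX v)
    rwa [tensId_pairT, tensId_pairT, hBe X hX, hBφ X hX, ← deltaOp_intertwine δ (hBint X hX v),
      hBu] at this
  -- The coefficients of u at Λ are combinations of the vectors y, which g₁ annihilates.
  have hB₁ : ∀ v, tensId _ (B Λ v) u₁ = 0 := by
    intro v
    ext1 i
    ext1 a
    have h1 : tensId _ (B Λ v) u₁ i a = ∑ j, v j • g₁ (y (i, j, a)) := by
      simp only [u₁, ← ampl_tensId]
      rw [ampl_apply, ampl_apply]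
      simp only [tensId_apply, WithLp.ofLp_sum, WithLp.ofLp_smul, Finset.sum_apply,
        Pi.smul_apply, B, Matrix.of_apply, y, map_sum, map_smul, Finset.sum_smul,
        Finset.smul_sum, smul_smul]
      exact Finset.sum_comm
    rw [h1]
    simp [hgy]
  have hΛsys : ∀ i v, U (WithLp.toLp 2 (pairT v (deltaOp δ Λ _ (vecEval u' Λ v)) i, 0)) =
      WithLp.toLp 2 (pairT (φ n Λ v) (vecEval u' Λ v) i, 0) := by
    intro i v
    have := hsys ⟨n, Λ⟩ (Finset.mem_insert_self _ _) v i
    simp only [hB₁, map_zero] at this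
    exact this
  refine ⟨transfer δ U, u', transfer_isNC hU, fun m x hx => transfer_norm_le hU hx, ?_, ?_, ?_⟩
  · intro X hX v
    exact (hsys X (Finset.mem_insert_of_mem hX) v).transfer_eq (isUnit_pencil hU (hF X hX))
  · intro i j v w
    have h1 := W.inner_map_map
      (WithLp.toLp 2 (pairT v (deltaOp δ Λ _ (vecEval u' Λ v)) i, 0))
      (WithLp.toLp 2 (pairT w (deltaOp δ Λ _ (vecEval u' Λ w)) j, 0))
    have h2 := hΛsys i v
    have h3 := hΛsys j w
    simp only [U, LinearIsometry.coe_toContinuousLinearMap] at h2 h3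
    rw [h2, h3] at h1
    exact (inner_pair_zero (F := Aux J (k * J)) _ _).symm.trans
      (h1.symm.trans (inner_pair_zero _ _))
  · intro m x hx c i v
    -- The zero state solves the system at every x for the input c ⊗ z, with z a Λ-vector, because U
    -- maps (z, 0) to a vector with zero state component.
    refine SystemEq.transfer_eq (isUnit_pencil hU hx) (w := 0) fun t => ?_
    have h1 : ∀ z : HSum ℂ (Aux J (auxDim n J)),
        (WithLp.toLp 2 (c t • z, 0) : HSum (HSum ℂ (Aux J (auxDim n J))) (Aux J (k * J))) =
          c t • WithLp.toLp 2 (z, 0) := fun z => hsum_ext (by simp) (by simp)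
    rw [map_zero]
    simp only [elemT_apply, PiLp.zero_apply]
    rw [h1, h1, map_smul, hΛsys]

end FiniteStage

/-! ### Realizations as limits of partial realizations -/

open Filter Topology

theorem Ultrafilter.exists_tendsto_of_bounded {ι X : Type} [NormedAddCommGroup X]
    [ProperSpace X] (𝒰 : Ultrafilter ι) {g : ι → X} {C : ℝ} (h : ∀ᶠ i in 𝒰, ‖g i‖ ≤ C) :
    ∃ a, Tendsto g 𝒰 (𝓝 a) := by
  obtain ⟨a, -, ha⟩ := (isCompact_closedBall (0 : X) C).ultrafilter_le_nhds (𝒰.map g) (by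
    rw [le_principal_iff]
    change ∀ᶠ i in 𝒰, g i ∈ Metric.closedBall 0 C
    filter_upwards [h] with i hi
    simpa using hi)
  exact ⟨a, ha⟩

section Limit

variable {E F : Type} [NormedAddCommGroup E] [InnerProductSpace ℂ E]
  [NormedAddCommGroup F] [InnerProductSpace ℂ F]

theorem pairT_eq {m : ℕ} (a : Tens m E) (b : Tens m F) :
    pairT a b = ampl m (inlL E F) a + ampl m (inrL E F) b := by
  ext1 i
  rw [PiLp.add_apply, ampl_apply, ampl_apply]
  exact hsum_ext (by simp [inlL_apply, inrL_apply]) (by simp [inlL_apply, inrL_apply])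

theorem tendsto_pairT {ι : Type} {l : Filter ι} {m : ℕ} {f : ι → Tens m E} {g : ι → Tens m F}
    {a : Tens m E} {b : Tens m F} (hf : Tendsto f l (𝓝 a)) (hg : Tendsto g l (𝓝 b)) :
    Tendsto (fun i => pairT (f i) (g i)) l (𝓝 (pairT a b)) := by
  simp only [pairT_eq]
  exact (((ampl m (inlL E F)).continuous.tendsto _).comp hf).add
    (((ampl m (inrL E F)).continuous.tendsto _).comp hg)

theorem tendsto_clm_apply {ι : Type} {l : Filter ι} {f : ι → E →L[ℂ] F} {g : ι → E}
    {T : E →L[ℂ] F} {v : E} (hf : Tendsto f l (𝓝 T)) (hg : Tendsto g l (𝓝 v)) :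
    Tendsto (fun i => f i (g i)) l (𝓝 (T v)) :=
  (isBoundedBilinearMap_apply.continuous.tendsto (T, v)).comp (hf.prodMk_nhds hg)

theorem continuous_elemT {m : ℕ} (c : Fin m → ℂ) : Continuous (elemT c : E → Tens m E) := by
  unfold elemT
  fun_prop

theorem tendsto_tens_apply {ι : Type} {l : Filter ι} {m : ℕ} {f : ι → Tens m E} {a : Tens m E}
    (hf : Tendsto f l (𝓝 a)) (i : Fin m) : Tendsto (fun s => f s i) l (𝓝 (a i)) :=
  ((PiLp.continuous_apply 2 _ i).tendsto _).comp hf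

variable {d J n : ℕ}

/-- The value at `Λ` as a linear map on vectors of free polynomials. -/
def vecEvalHom {l : ℕ} (Λ : Tup d n) : VecPoly d J l →ₗ[ℂ] (Tens n ℂ →L[ℂ] Tens n (Aux J l)) where
  toFun u := vecEval u Λ
  map_add' u v := by
    ext1 w; ext i a b
    simp [vecEval_apply, polyEval, mul_add, Finset.sum_add_distrib]
  map_smul' c u := by
    ext1 w; ext i a b
    simp only [vecEval_apply, RingHom.id_apply, smul_apply, PiLp.smul_apply,
      smul_eq_mul, Finset.mul_sum]
    refine Finset.sum_congr rfl fun j _ => ?_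
    simp only [polyEval, Pi.smul_apply, map_smul, Matrix.smul_apply, smul_eq_mul]
    ring

theorem mem_of_tendsto_finiteDimensional {X : Type} [NormedAddCommGroup X] [NormedSpace ℂ X]
    [FiniteDimensional ℂ X] (S : Submodule ℂ X) {ι : Type} {𝒰 : Filter ι} [NeBot 𝒰] {f : ι → X} {a : X}
    (h : Tendsto f 𝒰 (𝓝 a)) (hf : ∀ i, f i ∈ S) :
    a ∈ S :=
  S.closed_of_finiteDimensional.mem_of_tendsto h (Eventually.of_forall hf)

/-- The polynomials themselves may diverge along the filter. Only their values at Λ converge, and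
these values form a finite-dimensional, hence closed, subspace. -/
theorem exists_vecEval_of_tendsto {ι : Type} {𝒰 : Filter ι} [NeBot 𝒰] {l : ℕ} {Λ : Tup d n}
    {u : ι → VecPoly d J l} {ω : Tens n ℂ →L[ℂ] Tens n (Aux J l)}
    (h : Tendsto (fun i => vecEval (u i) Λ) 𝒰 (𝓝 ω)) : ∃ v : VecPoly d J l, vecEval v Λ = ω := by
  have := mem_of_tendsto_finiteDimensional (LinearMap.range (vecEvalHom (J := J) (l := l) Λ)) h
    fun i => ⟨u i, rfl⟩
  exact this

/-- Contractivity gives ‖y‖² + ‖w‖² ≤ ‖v‖² + ‖δ(x)‖²‖w‖². The resulting bound on w depends on x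
only, as needed for limits. -/
theorem state_norm_le {l : ℕ} {δ : PolyMat d J} {m : ℕ} {x : Tup d m} (hx : x ∈ gdel δ m)
    {Ξ : Tens m (HSum ℂ (Aux J l)) →L[ℂ] Tens m (HSum ℂ (Aux J l))} (hΞ : ‖Ξ‖ ≤ 1)
    {v y : Tens m ℂ} {w : Tens m (Aux J l)} (h : Ξ (pairT v (deltaOp δ x _ w)) = pairT y w) :
    ‖w‖ ≤ (Real.sqrt (1 - ‖deltaOp δ x ℂ‖ ^ 2))⁻¹ * ‖v‖ := by
  have hr : 0 < 1 - ‖deltaOp δ x ℂ‖ ^ 2 := by nlinarith [hx.2, norm_nonneg (deltaOp δ x ℂ)]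
  have h1 : ‖pairT y w‖ ^ 2 ≤ ‖pairT v (deltaOp δ x _ w)‖ ^ 2 := by
    rw [← h]
    gcongr
    exact (Ξ.le_of_opNorm_le hΞ _).trans (by rw [one_mul])
  rw [norm_sq_pairT, norm_sq_pairT] at h1
  have h2 := pow_le_pow_left₀ (norm_nonneg _) (deltaOp_norm_le δ x w) 2
  rw [mul_pow] at h2
  rw [← sq_le_sq₀ (norm_nonneg _) (by positivity), mul_pow, inv_pow, Real.sq_sqrt hr.le,
    inv_mul_eq_div, le_div_iff₀ hr]
  nlinarith [sq_nonneg ‖y‖]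

/-- **Realization theorem**: a contractive nc-function on `G_δ` has a realization which is
polynomial at `Λ`, with all state spaces but a finite-dimensional one eliminated. -/
theorem exists_realization (hJ : 0 < J) {δ : PolyMat d J} {φ : OpGraded d ℂ ℂ}
    (hφ : IsNC (gdel δ) φ) (hb : ∀ (m : ℕ) (x : Tup d m), x ∈ gdel δ m → ‖φ m x‖ ≤ 1)
    {Λ : Tup d n} (hΛ : Λ ∈ gdel δ n) :
    ∃ (Ξ : OpGraded d (HSum ℂ (Aux J (auxDim n J))) (HSum ℂ (Aux J (auxDim n J))))
      (u : VecPoly d J (auxDim n J)),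
      IsNC (gdel δ) Ξ ∧ (∀ (m : ℕ) (x : Tup d m), x ∈ gdel δ m → ‖Ξ m x‖ ≤ 1) ∧
      (∀ (m : ℕ) (x : Tup d m), x ∈ gdel δ m → ∀ v, ∃ w,
        Ξ m x (pairT v (deltaOp δ x _ w)) = pairT (φ m x v) w) ∧
      (∀ i j v w, inner ℂ (pairT v (deltaOp δ Λ _ (vecEval u Λ v)) i)
          (pairT w (deltaOp δ Λ _ (vecEval u Λ w)) j) =
        inner ℂ (pairT (φ n Λ v) (vecEval u Λ v) i) (pairT (φ n Λ w) (vecEval u Λ w) j)) ∧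
      ∀ (m : ℕ) (x : Tup d m), x ∈ gdel δ m → ∀ (c : Fin m → ℂ) i v,
        Ξ m x (elemT c (pairT v (deltaOp δ Λ _ (vecEval u Λ v)) i)) =
          elemT c (pairT (φ n Λ v) (vecEval u Λ v) i) := by
  classical
  let l := auxDim n J
  -- Discarding points outside G_δ allows all finite sets as indices. Along an ultrafilter finer
  -- than `atTop`, each point of G_δ eventually belongs to the index set.
  let good : Finset (Σ m, Tup d m) → Finset (Σ m, Tup d m) :=
    fun F => F.filter fun X => X.2 ∈ gdel δ X.1
  choose Ξf uf hnc hbd hsys hgram helem using fun F => exists_partial_realization hJ hφ hb hΛ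
    (good F) fun X hX => (Finset.mem_filter.1 hX).2
  let 𝒰 : Ultrafilter (Finset (Σ m, Tup d m)) := Ultrafilter.of atTop
  have hev : ∀ (m : ℕ) (x : Tup d m), x ∈ gdel δ m → ∀ᶠ F in 𝒰, (⟨m, x⟩ : Σ m, Tup d m) ∈ good F := by
    intro m x hx
    have : ∀ᶠ F in atTop, (⟨m, x⟩ : Σ m, Tup d m) ∈ good F := by
      filter_upwards [eventually_ge_atTop {(⟨m, x⟩ : Σ m, Tup d m)}] with F hF
      exact Finset.mem_filter.2 ⟨hF (Finset.mem_singleton_self _), hx⟩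
    exact this.filter_mono (Ultrafilter.of_le _)
  have hlimΞ : ∀ (m : ℕ) (x : Tup d m), ∃ T, x ∈ gdel δ m →
      Tendsto (fun F => Ξf F m x) 𝒰 (𝓝 T) := by
    intro m x
    by_cases hx : x ∈ gdel δ m
    · have : ProperSpace (Tens m (HSum ℂ (Aux J l)) →L[ℂ] Tens m (HSum ℂ (Aux J l))) :=
        FiniteDimensional.proper ℂ _
      obtain ⟨T, hT⟩ := Ultrafilter.exists_tendsto_of_bounded 𝒰 (g := fun F => Ξf F m x)
        (Eventually.of_forall fun F => hbd F m x hx)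
      exact ⟨T, fun _ => hT⟩
    · exact ⟨0, fun h => absurd h hx⟩
  choose Ξ hΞ using hlimΞ
  have hlimω : ∀ (m : ℕ) (x : Tup d m), x ∈ gdel δ m →
      ∃ T, Tendsto (fun F => vecEval (uf F) x) 𝒰 (𝓝 T) := by
    intro m x hx
    have : ProperSpace (Tens m ℂ →L[ℂ] Tens m (Aux J l)) := FiniteDimensional.proper ℂ _
    refine Ultrafilter.exists_tendsto_of_bounded 𝒰
      (C := (Real.sqrt (1 - ‖deltaOp δ x ℂ‖ ^ 2))⁻¹) ?_
    filter_upwards [hev m x hx] with F hF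
    exact ContinuousLinearMap.opNorm_le_bound _ (by positivity) fun v =>
      state_norm_le hx (hbd F m x hx) (hsys F ⟨m, x⟩ hF v)
  have happ : ∀ {m : ℕ} {x : Tup d m}, x ∈ gdel δ m → ∀ {f : Finset (Σ m, Tup d m) → _} {a},
      Tendsto f 𝒰 (𝓝 a) → Tendsto (fun F => Ξf F m x (f F)) 𝒰 (𝓝 (Ξ m x a)) :=
    fun hx _ _ hf => tendsto_clm_apply (hΞ _ _ hx) hf
  obtain ⟨ω, hω⟩ := hlimω n Λ hΛ
  obtain ⟨u, hu⟩ : ∃ u : VecPoly d J l, vecEval u Λ = ω :=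
    exists_vecEval_of_tendsto hω
  have hpv : ∀ v, Tendsto (fun F => pairT v (deltaOp δ Λ _ (vecEval (uf F) Λ v))) 𝒰
      (𝓝 (pairT v (deltaOp δ Λ _ (vecEval u Λ v)))) := fun v => by
    refine tendsto_pairT tendsto_const_nhds (((deltaOp δ Λ (EuclideanSpace ℂ (Fin l))).continuous.tendsto _).comp ?_)
    rw [hu]
    exact tendsto_clm_apply hω tendsto_const_nhds
  have hqv : ∀ v, Tendsto (fun F => pairT (φ n Λ v) (vecEval (uf F) Λ v)) 𝒰
      (𝓝 (pairT (φ n Λ v) (vecEval u Λ v))) := fun v => by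
    refine tendsto_pairT tendsto_const_nhds ?_
    rw [hu]
    exact tendsto_clm_apply hω tendsto_const_nhds
  refine ⟨Ξ, u, ?_, ?_, ?_, ?_, ?_⟩
  · refine isNC_of_intertwine fun hx hy L hL v => ?_
    refine tendsto_nhds_unique (happ hx tendsto_const_nhds) ?_
    refine (((tensId _ L).continuous.tendsto _).comp (happ hy tendsto_const_nhds)).congr
      fun F => ?_
    exact ((hnc F).intertwine hx hy hL v).symm
  · intro m x hx
    exact le_of_tendsto (hΞ m x hx).norm (Eventually.of_forall fun F => hbd F m x hx)
  · intro m x hx v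
    -- At a general x only the limit of the states survives; it need not be the value of the
    -- polynomial chosen at Λ.
    obtain ⟨T, hT⟩ := hlimω m x hx
    have hTv : Tendsto (fun F => vecEval (uf F) x v) 𝒰 (𝓝 (T v)) :=
      tendsto_clm_apply hT tendsto_const_nhds
    refine ⟨T v, tendsto_nhds_unique (happ hx (tendsto_pairT tendsto_const_nhds
      (((deltaOp δ x (EuclideanSpace ℂ (Fin l))).continuous.tendsto _).comp hTv))) ?_⟩
    refine (tendsto_pairT (tendsto_const_nhds (x := φ m x v)) hTv).congr' ?_
    filter_upwards [hev m x hx] with F hF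
    exact (hsys F ⟨m, x⟩ hF v).symm
  · intro i j v w
    refine tendsto_nhds_unique ((tendsto_tens_apply (hpv v) i).inner
      (tendsto_tens_apply (hpv w) j)) ?_
    refine ((tendsto_tens_apply (hqv v) i).inner (tendsto_tens_apply (hqv w) j)).congr fun F => ?_
    exact (hgram F i j v w).symm
  · intro m x hx c i v
    refine tendsto_nhds_unique (happ hx (((continuous_elemT c).tendsto _).comp
      (tendsto_tens_apply (hpv v) i))) ?_
    refine (((continuous_elemT c).tendsto _).comp (tendsto_tens_apply (hqv v) i)).congr fun F => ?_
    exact (helem F m x hx c i v).symm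

end Limit

/-! ### The unitary colligation of a factorization -/

section Unitary

variable {d J n l m : ℕ} {δ : PolyMat d J} {Λ : Tup d n} {p₀ : Poly d} {u : VecPoly d J l}
  (V : spaceN₂ δ Λ u ≃ₗᵢ[ℂ] spaceN₁ Λ p₀ u)

theorem decomp_add {S : Type} [NormedAddCommGroup S] [InnerProductSpace ℂ S]
    [FiniteDimensional ℂ S] (N : Submodule ℂ (HSum ℂ S)) (a : N) (b : Nᗮ) :
    decomp N ((a : HSum ℂ S) + b) = WithLp.toLp 2 (a, b) := by
  have h1 : N.orthogonalProjectionOnto (b : HSum ℂ S) = 0 :=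
    Submodule.orthogonalProjectionOnto_apply_of_mem_orthogonal b.2
  have h2 : Nᗮ.orthogonalProjectionOnto (a : HSum ℂ S) = 0 :=
    Submodule.orthogonalProjectionOnto_orthogonal_apply_eq_zero a.2
  rw [decomp, Submodule.orthogonalDecomposition_apply, map_add, map_add, h1, h2, add_zero,
    zero_add, Submodule.orthogonalProjectionOnto_mem_subspace_eq_self,
    Submodule.orthogonalProjectionOnto_mem_subspace_eq_self]

/-- Written without projections, U swaps m₁ and m₂ and applies V to n₂. Systems for U can then be
verified by exhibiting the two decompositions. -/
theorem opU_apply (n₂ : spaceN₂ δ Λ u) (m₂ : spM₂ V) (m₁ : spM₁ V) {a : ℂ} {s : Aux J l} {b : ℂ}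
    {t : Aux J l} (h : (n₂ : HSum ℂ (Aux J l)) + m₂ = WithLp.toLp 2 (a, s))
    (h' : (V n₂ : HSum ℂ (Aux J l)) + m₁ = WithLp.toLp 2 (b, t)) :
    opU V (WithLp.toLp 2 (WithLp.toLp 2 (a, m₁), s)) =
      WithLp.toLp 2 (WithLp.toLp 2 (b, m₂), t) := by
  have e1 : decomp (spaceN₂ δ Λ u) (WithLp.toLp 2 (a, s)) = WithLp.toLp 2 (n₂, m₂) := by
    rw [← h, decomp_add]
  have e2 : (decomp (spaceN₁ Λ p₀ u)).symm (WithLp.toLp 2 (V n₂, m₁)) = WithLp.toLp 2 (b, t) := by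
    rw [LinearIsometryEquiv.symm_apply_eq, ← h', decomp_add]
  change (regroup ℂ (spM₂ V) (Aux J l)).symm (WithLp.toLp 2
    (((decomp (spaceN₂ δ Λ u)) (WithLp.toLp 2 (a, s))).snd,
      (decomp (spaceN₁ Λ p₀ u)).symm (WithLp.toLp 2
        (V ((decomp (spaceN₂ δ Λ u)) (WithLp.toLp 2 (a, s))).fst, m₁)))) = _
  rw [e1]
  change (regroup ℂ (spM₂ V) (Aux J l)).symm (WithLp.toLp 2
    (m₂, (decomp (spaceN₁ Λ p₀ u)).symm (WithLp.toLp 2 (V n₂, m₁)))) = _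
  rw [e2]
  rfl

theorem toContinuousLinearEquiv_norm_le {E F : Type} [NormedAddCommGroup E]
    [InnerProductSpace ℂ E] [NormedAddCommGroup F] [InnerProductSpace ℂ F] (e : E ≃ₗᵢ[ℂ] F)
    (z : E) : ‖(e.toContinuousLinearEquiv : E →L[ℂ] F) z‖ ≤ ‖z‖ :=
  (e.norm_map z).le

theorem opU_eq : opU V = ((unitaryOf V).toContinuousLinearEquiv :
    HSum (HSum ℂ (spM₁ V)) (Aux J l) →L[ℂ] HSum (HSum ℂ (spM₂ V)) (Aux J l)) := rfl

theorem unitaryOf_norm_le (z : HSum (HSum ℂ (spM₁ V)) (Aux J l)) :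
    ‖((unitaryOf V).toContinuousLinearEquiv :
      HSum (HSum ℂ (spM₁ V)) (Aux J l) →L[ℂ] HSum (HSum ℂ (spM₂ V)) (Aux J l)) z‖ ≤ ‖z‖ :=
  toContinuousLinearEquiv_norm_le (unitaryOf V) z

theorem opU_norm (z : HSum (HSum ℂ (spM₁ V)) (Aux J l)) : ‖opU V z‖ ≤ ‖z‖ := by
  rw [opU_eq]
  exact unitaryOf_norm_le V z

theorem isUnit_pencil_opU {x : Tup d m} (hx : x ∈ gdel δ m) : IsUnit (pencil δ (opU V) x) :=
  isUnit_pencil (opU_norm V) hx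

theorem ampl_inr_eq {E F : Type} [NormedAddCommGroup E] [InnerProductSpace ℂ E]
    [NormedAddCommGroup F] [InnerProductSpace ℂ F] (b : Tens m F) :
    ampl m (inrL E F) b = pairT 0 b := by
  rw [pairT_eq, map_zero, zero_add]

/-- `G₂₂(x)` is a strict contraction. -/
theorem fnG₂₂_norm_lt {x : Tup d m} (hx : x ∈ gdel δ m) {b : Tens m (spM₁ V)} (hb : b ≠ 0) :
    ‖fnG₂₂ V m x b‖ < ‖b‖ := by
  obtain ⟨w, hw⟩ := exists_systemEq (isUnit_pencil_opU V hx) (pairT 0 b)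
  have hG : fnG₂₂ V m x b = ampl m (sndL ℂ (spM₂ V)) (transfer δ (opU V) m x (pairT 0 b)) := by
    rw [← ampl_inr_eq]; rfl
  -- With zero state, each component of the input to U is (0, b i, 0), which U sends to a vector
  -- whose M₂-component is 0, so G₂₂(x)b = 0. With w ≠ 0, the strict inequality ‖δ(x)w‖ < ‖w‖ enters
  -- the energy balance.
  by_cases hw0 : w = 0
  · have : fnG₂₂ V m x b = 0 := by
      rw [hG]
      ext1 i
      have h1 := hw i
      rw [hw0, map_zero] at h1
      have h2 := opU_apply V 0 0 (b i) (a := 0) (s := 0) (b := (b i : HSum ℂ (Aux J l)).fst)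
        (t := (b i : HSum ℂ (Aux J l)).snd) (by simp; rfl) (by simp; rfl)
      have h3 := h1.symm.trans h2
      rw [ampl_apply]
      exact congrArg (fun z => WithLp.snd (WithLp.fst z)) h3
    rw [this, norm_zero]
    exact norm_pos_iff.2 hb
  · have h1 := hw.norm_sq_le (opU_norm V)
    have h2 := pow_lt_pow_left₀ (deltaOp_norm_lt hx hw0) (norm_nonneg _) two_ne_zero
    have h3 : ‖ampl m (sndL ℂ (spM₂ V)) (transfer δ (opU V) m x (pairT 0 b))‖ ≤
        ‖transfer δ (opU V) m x (pairT 0 b)‖ := by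
      refine ampl_norm_le (fun z => ?_) _
      rw [← sq_le_sq₀ (norm_nonneg _) (norm_nonneg _), hsum_norm_sq z]
      exact le_add_of_nonneg_left (sq_nonneg _)
    have h4 := pow_le_pow_left₀ (norm_nonneg _) h3 2
    rw [norm_sq_pairT, norm_zero] at h1
    rw [hG, ← sq_lt_sq₀ (norm_nonneg _) (norm_nonneg _)]
    linarith

theorem isUnit_one_sub_fnG₂₂ {x : Tup d m} (hx : x ∈ gdel δ m)
    {T : Tens m (spM₂ V) →L[ℂ] Tens m (spM₁ V)} (hT : ‖T‖ ≤ 1) :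
    IsUnit (1 - fnG₂₂ V m x ∘L T) := by
  refine isUnit_of_injective _ fun a ha => ?_
  have h1 : a = fnG₂₂ V m x (T a) := sub_eq_zero.1 ha
  by_cases h0 : T a = 0
  · rw [h1, h0, map_zero]
  · have h2 := fnG₂₂_norm_lt V hx h0
    rw [← h1] at h2
    have h3 := T.le_of_opNorm_le hT a
    linarith

/-- Feeding m₁ = Θm₂ back into U gives m₂ = G₂₁v + G₂₂Θm₂. Invertibility of I - G₂₂Θ makes m₂
unique, so any solution of the closed loop computes the transform. -/
theorem lft_apply_eq {x : Tup d m} (hx : x ∈ gdel δ m) {Θ : OpGraded d (spM₂ V) (spM₁ V)}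
    (hΘ : ‖Θ m x‖ ≤ 1) {v y : Tens m ℂ} {m₂ : Tens m (spM₂ V)} {w : Tens m (Aux J l)}
    (h : SystemEq δ (opU V) x (pairT v (Θ m x m₂)) w (pairT y m₂)) : lft V Θ m x v = y := by
  have h1 := h.transfer_eq (isUnit_pencil_opU V hx)
  rw [pairT_eq, map_add] at h1
  have h2 : fnG₁₁ V m x v + fnG₁₂ V m x (Θ m x m₂) = y := by
    have := congrArg (ampl m (fstL ℂ (spM₂ V))) h1
    rw [map_add] at this
    exact this.trans (by ext i; rw [ampl_apply]; rfl)
  have h3 : fnG₂₁ V m x v + fnG₂₂ V m x (Θ m x m₂) = m₂ := by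
    have := congrArg (ampl m (sndL ℂ (spM₂ V))) h1
    rw [map_add] at this
    exact this.trans (by ext1 i; rw [ampl_apply]; rfl)
  have h4 : (1 - fnG₂₂ V m x ∘L Θ m x) m₂ = fnG₂₁ V m x v := by
    rw [sub_apply, one_apply_eq_self, sub_eq_iff_eq_add]
    exact h3.symm
  have h5 : Ring.inverse (1 - fnG₂₂ V m x ∘L Θ m x) (fnG₂₁ V m x v) = m₂ := by
    rw [← h4, ← mul_apply_eq_comp, Ring.inverse_mul_cancel _ (isUnit_one_sub_fnG₂₂ V hx hΘ)]
    rfl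
  rw [← h2]
  change fnG₁₁ V m x v + fnG₁₂ V m x (Θ m x (Ring.inverse (1 - fnG₂₂ V m x ∘L Θ m x)
    (fnG₂₁ V m x v))) = _
  rw [h5]

/-- The linear fractional transforms interpolate at `Λ`. -/
theorem lft_interpolates (hΛ : Λ ∈ gdel δ n) (hV : Intertwines δ Λ p₀ u V)
    {Θ : OpGraded d (spM₂ V) (spM₁ V)} (hΘ : ‖Θ n Λ‖ ≤ 1) :
    lft V Θ n Λ = tensId ℂ (polyEval p₀ Λ) := by
  ext1 v
  -- The input vectors p_{k,v} lie in N₂ and their images q_{k,v} in N₁, so both M-components are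
  -- zero and Θ only ever acts on 0.
  refine lft_apply_eq V hΛ hΘ (m₂ := 0) (w := vecEval u Λ v) fun k => ?_
  rw [map_zero]
  refine opU_apply V ⟨vecP δ Λ u k v, vecP_mem δ Λ u k v⟩ 0 0 ?_ ?_
  · simp [vecP]
  · rw [hV]
    simp [vecQ]

end Unitary

/-! ### Parametrization of the solutions -/

section Compress

variable {E F : Type} [NormedAddCommGroup E] [InnerProductSpace ℂ E] [FiniteDimensional ℂ E]
  [NormedAddCommGroup F] [InnerProductSpace ℂ F] [FiniteDimensional ℂ F] {m : ℕ}

/-- A contraction preserves the inner products with vectors whose norm it preserves. -/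
theorem inner_map_of_norm_eq {T : E →L[ℂ] F} (hT : ‖T‖ ≤ 1) {g : E} (hg : ‖T g‖ = ‖g‖) (h : E) :
    inner ℂ (T g) (T h) = inner ℂ g h := by
  have := FiniteDimensional.complete ℂ E
  have := FiniteDimensional.complete ℂ F
  -- ‖T*Tg - g‖² = ‖T*Tg‖² - 2‖Tg‖² + ‖g‖², which is at most 0 when ‖Tg‖ = ‖g‖ and ‖T*‖ ≤ 1.
  have h1 : ContinuousLinearMap.adjoint T (T g) = g := by
    rw [← sub_eq_zero, ← norm_eq_zero, ← sq_eq_zero_iff]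
    refine le_antisymm ?_ (sq_nonneg _)
    rw [@norm_sub_sq ℂ, ContinuousLinearMap.adjoint_inner_left, inner_self_eq_norm_sq (𝕜 := ℂ)]
    have h2 : ‖ContinuousLinearMap.adjoint T (T g)‖ ≤ ‖g‖ := by
      rw [← hg]
      refine (ContinuousLinearMap.le_of_opNorm_le _ (c := 1) ?_ _).trans (by rw [one_mul])
      rwa [LinearIsometryEquiv.norm_map]
    have h3 := pow_le_pow_left₀ (norm_nonneg _) h2 2
    rw [hg]
    linarith
  rw [← ContinuousLinearMap.adjoint_inner_left, h1]

theorem elemT_inner (c : Fin m → ℂ) (z : E) (t : Tens m E) :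
    inner ℂ (elemT c z) t = ∑ i, inner ℂ (c i • z) (t i) :=
  tens_inner _ _

theorem sum_elemT (b : Tens m E) : ∑ i, elemT (Pi.single i 1) (b i) = b := by
  ext1 j
  rw [WithLp.ofLp_sum, Finset.sum_apply, Finset.sum_eq_single j]
  · simp
  · intro i _ hi
    simp [hi.symm]
  · simp

variable {N₁ N₂ : Submodule ℂ E} {W : E →ₗᵢ[ℂ] E} {Ξ : Tens m E →L[ℂ] Tens m E}

theorem map_of_mem (h : ∀ (c : Fin m → ℂ), ∀ z ∈ N₂, Ξ (elemT c z) = elemT c (W z))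
    {t : Tens m E} (ht : ∀ i, t i ∈ N₂) (i : Fin m) : Ξ t i = W (t i) := by
  have : Ξ t = ∑ j, elemT (Pi.single j 1) (W (t j)) := by
    conv_lhs => rw [← sum_elemT t]
    rw [map_sum]
    exact Finset.sum_congr rfl fun j _ => h _ _ (ht j)
  rw [this]
  have h2 := sum_elemT (ampl m W.toContinuousLinearMap t)
  simp only [ampl_apply, LinearIsometry.coe_toContinuousLinearMap] at h2
  rw [h2, ampl_apply]
  rfl

/-- On elementary tensors from N₂ the contraction Ξ preserves norms, hence also inner products with
every vector. Since W carries N₂ onto all of N₁, orthogonality to N₂ becomes orthogonality to N₁. -/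
theorem map_of_mem_orthogonal (hΞ : ‖Ξ‖ ≤ 1) (hW : ∀ z₁ ∈ N₁, ∃ z ∈ N₂, W z = z₁)
    (h : ∀ (c : Fin m → ℂ), ∀ z ∈ N₂, Ξ (elemT c z) = elemT c (W z))
    {t : Tens m E} (ht : ∀ i, t i ∈ N₂ᗮ) (i : Fin m) : Ξ t i ∈ N₁ᗮ := by
  rw [Submodule.mem_orthogonal]
  intro z₁ hz₁
  obtain ⟨z, hz, rfl⟩ := hW z₁ hz₁
  have hn : ‖Ξ (elemT (Pi.single i 1) z)‖ = ‖(elemT (Pi.single i 1) z : Tens m E)‖ := by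
    rw [h _ z hz, ← sq_eq_sq₀ (norm_nonneg _) (norm_nonneg _), tens_norm_sq, tens_norm_sq]
    simp [norm_smul]
  have h1 := inner_map_of_norm_eq hΞ hn t
  rw [h _ z hz, elemT_inner, elemT_inner] at h1
  have h2 : ∀ (y : E) (s : Tens m E), ∑ j, inner ℂ ((Pi.single i 1 : Fin m → ℂ) j • y) (s j) =
      inner ℂ y (s i) := by
    intro y s
    rw [Finset.sum_eq_single i]
    · simp
    · intro j _ hj; simp [hj]
    · simp
  rw [h2, h2] at h1
  rw [h1]
  exact Submodule.inner_right_of_mem_orthogonal hz (ht i)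

/-- The compression of an operator to the orthogonal complements of two subspaces. -/
def compress (N₁ N₂ : Submodule ℂ E) (Ξ : Tens m E →L[ℂ] Tens m E) :
    Tens m N₂ᗮ →L[ℂ] Tens m N₁ᗮ :=
  ampl m N₁ᗮ.orthogonalProjectionOnto ∘L Ξ ∘L ampl m N₂ᗮ.subtypeL

theorem norm_compress_le (hΞ : ‖Ξ‖ ≤ 1) : ‖compress N₁ N₂ Ξ‖ ≤ 1 := by
  refine ContinuousLinearMap.opNorm_le_bound _ zero_le_one fun v => ?_
  have h1 : ‖ampl m N₂ᗮ.subtypeL v‖ ≤ ‖v‖ := ampl_norm_le (fun z => le_rfl) v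
  have h2 : ∀ z, ‖N₁ᗮ.orthogonalProjectionOnto z‖ ≤ ‖z‖ := fun z => by
    refine (ContinuousLinearMap.le_of_opNorm_le _
      (Submodule.orthogonalProjectionOnto_norm_le _) z).trans (by rw [one_mul])
  refine (ampl_norm_le h2 _).trans ((Ξ.le_of_opNorm_le hΞ _).trans ?_)
  rw [one_mul, one_mul]
  exact h1

theorem compress_tensId {k : ℕ} {Ξ' : Tens k E →L[ℂ] Tens k E} {L : Matrix (Fin k) (Fin m) ℂ}
    (h : ∀ v, Ξ' (tensId E L v) = tensId E L (Ξ v)) (v : Tens m N₂ᗮ) :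
    compress N₁ N₂ Ξ' (tensId _ L v) = tensId _ L (compress N₁ N₂ Ξ v) := by
  simp only [compress, ContinuousLinearMap.comp_apply]
  rw [ampl_tensId, h, ampl_tensId]

theorem isNC_compress {d J : ℕ} {δ : PolyMat d J} {Ξ : OpGraded d E E}
    (h : IsNC (gdel δ) Ξ) : IsNC (gdel δ) fun m x => compress N₁ N₂ (Ξ m x) :=
  isNC_of_intertwine fun hx hy _ hL v => compress_tensId (h.intertwine hx hy hL) v

/-- Ξ is block diagonal for E = N₂ ⊕ N₂ᗮ and E = N₁ ⊕ N₁ᗮ, with blocks I ⊗ W and its compression, so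
compressing loses nothing. -/
theorem exists_compress_split (hΞ : ‖Ξ‖ ≤ 1) (hW : ∀ z₁ ∈ N₁, ∃ z ∈ N₂, W z = z₁)
    (h : ∀ (c : Fin m → ℂ), ∀ z ∈ N₂, Ξ (elemT c z) = elemT c (W z)) (t : Tens m E) :
    ∃ (n₂ : Tens m N₂) (m₂ : Tens m N₂ᗮ), ∀ i, (n₂ i : E) + m₂ i = t i ∧
      W (n₂ i) + compress N₁ N₂ Ξ m₂ i = Ξ t i := by
  let n₂ : Tens m N₂ := ampl m N₂.orthogonalProjectionOnto t
  let m₂ : Tens m N₂ᗮ := ampl m N₂ᗮ.orthogonalProjectionOnto t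
  have hsplit : ∀ i, (n₂ i : E) + m₂ i = t i := by
    intro i
    simp only [n₂, m₂, ampl_apply]
    exact Submodule.starProjection_add_starProjection_orthogonal (t i)
  let tn : Tens m E := ampl m N₂.subtypeL n₂
  let tm : Tens m E := ampl m N₂ᗮ.subtypeL m₂
  have htn : ∀ i, tn i = n₂ i := fun i => ampl_apply _ _ _ _
  have htm : ∀ i, tm i = m₂ i := fun i => ampl_apply _ _ _ _
  have hsum : t = tn + tm := by
    ext1 i
    rw [PiLp.add_apply, htn, htm, hsplit]
  have h1 : ∀ i, Ξ tn i = W (n₂ i) := fun i => by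
    rw [map_of_mem h (fun i => by rw [htn]; exact (n₂ i).2), htn]
  have h2 : ∀ i, Ξ tm i ∈ N₁ᗮ :=
    map_of_mem_orthogonal hΞ hW h (fun i => by rw [htm]; exact (m₂ i).2)
  have h3 : ∀ i, (compress N₁ N₂ Ξ m₂ i : E) = Ξ tm i := by
    intro i
    simp only [compress, ContinuousLinearMap.comp_apply]
    rw [ampl_apply]
    exact Submodule.starProjection_eq_self_iff.2 (h2 i)
  refine ⟨n₂, m₂, fun i => ⟨hsplit i, ?_⟩⟩
  rw [h3, ← h1, ← PiLp.add_apply, ← map_add, ← hsum]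

theorem map_elemT_of_mem_span {S : Set E} {c : Fin m → ℂ}
    (h : ∀ z ∈ S, Ξ (elemT c z) = elemT c (W z)) {z : E} (hz : z ∈ Submodule.span ℂ S) :
    Ξ (elemT c z) = elemT c (W z) := by
  induction hz using Submodule.span_induction with
  | mem z hz => exact h z hz
  | zero =>
    have : (elemT c (0 : E) : Tens m E) = 0 := by ext1 i; simp
    rw [map_zero, this, map_zero]
  | add y z _ _ hy hz =>
    have hadd : ∀ y z : E, (elemT c (y + z) : Tens m E) = elemT c y + elemT c z := by
      intro y z; ext1 i; simp
    rw [hadd, map_add, map_add, hadd, hy, hz]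
  | smul a z _ hz =>
    have hsmul : ∀ z : E, (elemT c (a • z) : Tens m E) = a • elemT c z := by
      intro z; ext1 i
      rw [elemT_apply, PiLp.smul_apply, elemT_apply, smul_comm]
    rw [hsmul, map_smul, map_smul, hsmul, hz]

end Compress

/-! ### From a realization to the data u, V and Θ -/

section Parametrization

variable {d J n l : ℕ} {δ : PolyMat d J} {Λ : Tup d n} {p₀ : Poly d} {u : VecPoly d J l}

/-- The factorization is the sum over k of the diagonal Gram identities i = j = k. The full family
of identities is what yields V. -/
theorem factorization_of_gram
    (h : ∀ i j v w, inner ℂ (vecP δ Λ u i v) (vecP δ Λ u j w) =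
      inner ℂ (vecQ Λ p₀ u i v) (vecQ Λ p₀ u j w)) : Factorization δ Λ p₀ u := by
  refine ContinuousLinearMap.ext fun w => ext_inner_left ℂ fun v => ?_
  have h1 := Finset.sum_congr rfl fun k (_ : k ∈ Finset.univ) => h k k v w
  simp only [vecP, vecQ, pair_inner, Finset.sum_add_distrib] at h1
  rw [← tens_inner, ← tens_inner, ← tens_inner, ← tens_inner] at h1
  simp only [sub_apply, ContinuousLinearMap.comp_apply, one_apply_eq_self, inner_sub_right,
    ContinuousLinearMap.adjoint_inner_right, map_sub]
  linear_combination h1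

theorem exists_intertwining
    (h : ∀ i j v w, inner ℂ (vecP δ Λ u i v) (vecP δ Λ u j w) =
      inner ℂ (vecQ Λ p₀ u i v) (vecQ Λ p₀ u j w)) :
    ∃ (W : HSum ℂ (Aux J l) →ₗᵢ[ℂ] HSum ℂ (Aux J l))
      (V : spaceN₂ δ Λ u ≃ₗᵢ[ℂ] spaceN₁ Λ p₀ u),
      Intertwines δ Λ p₀ u V ∧ (∀ k v, W (vecP δ Λ u k v) = vecQ Λ p₀ u k v) ∧
      ∀ z, (V z : HSum ℂ (Aux J l)) = W z := by
  obtain ⟨W, hW⟩ := exists_isometry_of_gram (p := fun z : Fin n × Tens n ℂ => vecP δ Λ u z.1 z.2)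
    (q := fun z : Fin n × Tens n ℂ => vecQ Λ p₀ u z.1 z.2) fun i j => h i.1 j.1 i.2 j.2
  have hW' : ∀ k v, W (vecP δ Λ u k v) = vecQ Λ p₀ u k v := fun k v => hW (k, v)
  have hmap : (spaceN₂ δ Λ u).map (W : HSum ℂ (Aux J l) →ₗ[ℂ] HSum ℂ (Aux J l)) =
      spaceN₁ Λ p₀ u := by
    rw [spaceN₂, spaceN₁, Submodule.map_span]
    congr 1
    ext z
    constructor
    · rintro ⟨_, ⟨k, v, rfl⟩, rfl⟩
      exact ⟨k, v, hW' k v⟩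
    · rintro ⟨k, v, rfl⟩
      exact ⟨_, ⟨k, v, rfl⟩, hW' k v⟩
  let f : spaceN₂ δ Λ u →ₗᵢ[ℂ] spaceN₁ Λ p₀ u :=
    ⟨(W : HSum ℂ (Aux J l) →ₗ[ℂ] HSum ℂ (Aux J l)).restrict fun z hz =>
      hmap ▸ Submodule.mem_map_of_mem hz, fun z => W.norm_map z⟩
  have hf : Function.Surjective f := by
    rintro ⟨z, hz⟩
    rw [← hmap] at hz
    obtain ⟨y, hy, rfl⟩ := hz
    exact ⟨⟨y, hy⟩, rfl⟩
  exact ⟨W, LinearIsometryEquiv.ofSurjective f hf, fun k v => hW' k v, hW', fun z => rfl⟩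

/-- Splitting the input (v, δ(x)w) of Ξ into n₂ + m₂ gives the output (φ(x)v, w) = Vn₂ + Θm₂. These
are exactly the two decompositions that describe U with m₁ = Θm₂, so the loop is closed and its
output is φ(x)v. -/
theorem lft_compress {m : ℕ} {x : Tup d m} (hx : x ∈ gdel δ m) {φ : OpGraded d ℂ ℂ}
    {Ξ : OpGraded d (HSum ℂ (Aux J l)) (HSum ℂ (Aux J l))} (hbd : ‖Ξ m x‖ ≤ 1)
    {v : Tens m ℂ} {w : Tens m (Aux J l)}
    (hsys : Ξ m x (pairT v (deltaOp δ x _ w)) = pairT (φ m x v) w)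
    {W : HSum ℂ (Aux J l) →ₗᵢ[ℂ] HSum ℂ (Aux J l)}
    (V : spaceN₂ δ Λ u ≃ₗᵢ[ℂ] spaceN₁ Λ p₀ u)
    (hVW : ∀ z, (V z : HSum ℂ (Aux J l)) = W z)
    (helem : ∀ (c : Fin m → ℂ),
      ∀ z ∈ spaceN₂ δ Λ u, Ξ m x (elemT c z) = elemT c (W z))
    (Θ : OpGraded d (spM₂ V) (spM₁ V))
    (hΘ : Θ m x = compress (spaceN₁ Λ p₀ u) (spaceN₂ δ Λ u) (Ξ m x)) :
    lft V Θ m x v = φ m x v := by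
  have hW : ∀ z₁ ∈ spaceN₁ Λ p₀ u, ∃ z ∈ spaceN₂ δ Λ u, W z = z₁ := fun z₁ hz₁ =>
    ⟨V.symm ⟨z₁, hz₁⟩, (V.symm ⟨z₁, hz₁⟩).2, by rw [← hVW, V.apply_symm_apply]⟩
  obtain ⟨n₂, m₂, h⟩ := exists_compress_split hbd hW helem (pairT v (deltaOp δ x _ w))
  have hΘ1 : ‖Θ m x‖ ≤ 1 := by
    rw [hΘ]; exact norm_compress_le hbd
  refine lft_apply_eq V hx hΘ1 (m₂ := m₂) (w := w) fun i => ?_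
  have h2 := (h i).2
  rw [← hΘ, ← hVW, hsys] at h2
  exact opU_apply V (n₂ i) (m₂ i) (Θ m x m₂ i) (h i).1 h2

/-- The parameter `Θ` of a solution, obtained from a realization by compression. -/
theorem exists_parameter (hJ : 0 < J) {φ : OpGraded d ℂ ℂ}
    {Ξ : OpGraded d (HSum ℂ (Aux J l)) (HSum ℂ (Aux J l))} (hnc : IsNC (gdel δ) Ξ)
    (hbd : ∀ (m : ℕ) (x : Tup d m), x ∈ gdel δ m → ‖Ξ m x‖ ≤ 1)
    (hsys : ∀ (m : ℕ) (x : Tup d m), x ∈ gdel δ m → ∀ v, ∃ w,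
        Ξ m x (pairT v (deltaOp δ x _ w)) = pairT (φ m x v) w)
    {W : HSum ℂ (Aux J l) →ₗᵢ[ℂ] HSum ℂ (Aux J l)}
    (V : spaceN₂ δ Λ u ≃ₗᵢ[ℂ] spaceN₁ Λ p₀ u)
    (hVW : ∀ z, (V z : HSum ℂ (Aux J l)) = W z)
    (helem : ∀ (m : ℕ) (x : Tup d m), x ∈ gdel δ m → ∀ (c : Fin m → ℂ),
      ∀ z ∈ spaceN₂ δ Λ u, Ξ m x (elemT c z) = elemT c (W z)) :
    ∃ Θ : OpGraded d (spM₂ V) (spM₁ V), InBall (gdel δ) Θ ∧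
      ∀ (m : ℕ) (x : Tup d m), x ∈ gdel δ m → φ m x = lft V Θ m x := by
  let Θ : OpGraded d (spM₂ V) (spM₁ V) :=
    fun m x => compress (spaceN₁ Λ p₀ u) (spaceN₂ δ Λ u) (Ξ m x)
  have hΘ1 : ∀ (m : ℕ) (x : Tup d m), x ∈ gdel δ m → ‖Θ m x‖ ≤ 1 :=
    fun m x hx => norm_compress_le (hbd m x hx)
  have hΘ : IsNC (gdel δ) Θ := isNC_compress hnc
  refine ⟨Θ, inBall_of_isNC hJ hΘ hΘ1,
    fun m x hx => ContinuousLinearMap.ext fun v => ?_⟩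
  obtain ⟨w, hw⟩ := hsys m x hx v
  exact (lft_compress hx (hbd m x hx) hw V hVW (helem m x hx) Θ rfl).symm

theorem tensId_injective {m : ℕ} {A B : Matrix (Fin m) (Fin m) ℂ}
    (h : tensId ℂ A = tensId ℂ B) : A = B := by
  ext i j
  have := congrArg (fun T : Tens m ℂ →L[ℂ] Tens m ℂ => T (EuclideanSpace.single j 1) i) h
  simpa [tensId_apply] using this

end Parametrization

end FreePick

end

theorem theorem4p1 {d J n : ℕ} (hJ : 0 < J) (δ : FreePick.PolyMat d J)
    (Λ : FreePick.Tup d n) (hΛ : Λ ∈ FreePick.gdel δ n) (p₀ : FreePick.Poly d)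
    (hsolv : ∃ ψ : FreePick.Graded d,
      FreePick.InBall (FreePick.gdel δ) ψ.toOp ∧ ψ n Λ = FreePick.polyEval p₀ Λ) :
    -- all inverses in the formulas below exist
    (∀ (l : ℕ) (u : FreePick.VecPoly d J l)
      (V : FreePick.spaceN₂ δ Λ u ≃ₗᵢ[ℂ] FreePick.spaceN₁ Λ p₀ u),
      FreePick.Factorization δ Λ p₀ u → FreePick.Intertwines δ Λ p₀ u V →
      ∀ (m : ℕ) (x : FreePick.Tup d m), x ∈ FreePick.gdel δ m →
        IsUnit (FreePick.pencil δ (FreePick.opU V) x) ∧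
        ∀ Θ : FreePick.OpGraded d (FreePick.spM₂ V) (FreePick.spM₁ V),
          FreePick.InBall (FreePick.gdel δ) Θ →
          IsUnit (1 - FreePick.fnG₂₂ V m x ∘L Θ m x)) ∧
    -- the description of the solutions
    ∀ φ : FreePick.Graded d, FreePick.InBall (FreePick.gdel δ) φ.toOp →
      (φ n Λ = FreePick.polyEval p₀ Λ ↔
        ∃ (l : ℕ) (u : FreePick.VecPoly d J l)
          (V : FreePick.spaceN₂ δ Λ u ≃ₗᵢ[ℂ] FreePick.spaceN₁ Λ p₀ u),
          FreePick.Factorization δ Λ p₀ u ∧ FreePick.Intertwines δ Λ p₀ u V ∧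
          ∃ Θ : FreePick.OpGraded d (FreePick.spM₂ V) (FreePick.spM₁ V),
            FreePick.InBall (FreePick.gdel δ) Θ ∧
            ∀ (m : ℕ) (x : FreePick.Tup d m), x ∈ FreePick.gdel δ m →
              φ.toOp m x = FreePick.lft V Θ m x) := by
  refine ⟨fun l u V _ _ m x hx => ⟨FreePick.isUnit_pencil_opU V hx, fun Θ hΘ =>
    FreePick.isUnit_one_sub_fnG₂₂ V hx (hΘ.2 m x hx)⟩, fun φ hφ => ⟨fun hφΛ => ?_, ?_⟩⟩
  · obtain ⟨Ξ, u, hnc, hbd, hsys, hgram, helem⟩ :=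
      FreePick.exists_realization hJ hφ.1.isNC hφ.2 hΛ
    have hΛφ : φ.toOp n Λ = FreePick.tensId ℂ (FreePick.polyEval p₀ Λ) := by
      rw [← hφΛ]; rfl
    rw [hΛφ] at hgram helem
    have hg : ∀ i j v w, inner ℂ (FreePick.vecP δ Λ u i v) (FreePick.vecP δ Λ u j w) =
        inner ℂ (FreePick.vecQ Λ p₀ u i v) (FreePick.vecQ Λ p₀ u j w) := hgram
    obtain ⟨W, V, hV, hW, hVW⟩ := FreePick.exists_intertwining hg
    -- The realization gives the action of Ξ on tensors c ⊗ p_{k,v}; by linearity it is I ⊗ W on all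
    -- of ℂ^m ⊗ N₂.
    obtain ⟨Θ, hΘ, hlft⟩ := FreePick.exists_parameter hJ hnc hbd hsys V hVW (by
      intro m x hx c z hz
      refine FreePick.map_elemT_of_mem_span (fun z hz => ?_) hz
      obtain ⟨k, v, rfl⟩ := hz
      rw [hW]
      exact helem m x hx c k v)
    exact ⟨_, u, V, FreePick.factorization_of_gram hg, hV, Θ, hΘ, hlft⟩
  · rintro ⟨l, u, V, -, hV, Θ, hΘ, hlft⟩
    refine FreePick.tensId_injective ?_
    exact (hlft n Λ hΛ).trans (FreePick.lft_interpolates V hΛ hV (hΘ.2 n Λ hΛ))
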